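/- Let $0\le k<N$, $\lambda\ge 0$ and $\mu_1>\mu_2>0$, and let $G$ be a graph on the vertex set (servers) $\{1,\dots,N\}$ with minimum degree at least $N-k-1$. *Graph model.* At each vertex $v$ jobs arrive independently as a Poisson process of rate $\lambda$; the primary servers of such a job are $v$ and its neighbours in $G$, all other servers are secondary. An arriving job is allocated as a type I job to an idle primary server if there is one (idle: no jobs of either type); otherwise as a type II job to an idle secondary server if there is one; otherwise as a type I job to a primary server with the smallest number of type I jobs, ties being broken in favour of the smallest number of type II jobs. Remaining ties are broken by an arbitrary, possibly randomized, rule depending on the current configuration and on $v$. Each server gives preemptive priority to type I jobs; type I (type II) jobs have independent exponential service times with parameter $\mu_1$ ($\mu_2$). Thus the numbers of type I and type II jobs at the servers form a Markov jump process. Let $\overline Q^{\mathrm{aff}}_i(t)$ be the number of servers with at least $i$ type I jobs at time $t$. *Reference system MJSQ($k$).* There are $N$ servers, jobs arrive as a Poisson process of total rate $\lambda N$, each job joins a server with the $(k+1)$-th smallest queue length (ties broken by an arbitrary, possibly randomized, rule depending on the current configuration), and each server works at exponential rate $\mu_1$ while it has jobs. Let $\overline Q^{\mathrm{MJSQ}(k)}_i(t)$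 be the number of servers with at least $i$ jobs at time $t$. Put $\overline Q_{m+}(t)=\sum_{i\ge m}\overline Q_i(t)$ in both systems. Suppose that the initial configurations satisfy $\overline Q^{\mathrm{aff}}_{m+}(0)\le\overline Q^{\mathrm{MJSQ}(k)}_{m+}(0)$ for all $m\ge1$ (for random initial configurations: that they can be coupled such that this holds almost surely). Then $$\{(\overline Q^{\mathrm{aff}}_{m+}(t))_{m\ge1}\}_{t\ge0}\ \le_{\mathrm{st}}\ \{(\overline Q^{\mathrm{MJSQ}(k)}_{m+}(t))_{m\ge1}\}_{t\ge0},$$ that is, there are processes on a joint probability space with right-continuous paths and with the same laws (as processes) as the left-hand and right-hand side, respectively, such that almost surely the inequality holds for all $t\ge0$ and all $m\ge1$ simultaneously. -/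

import Mathlib

open MeasureTheory ProbabilityTheory Filter Topology
open scoped NNReal

noncomputable section

namespace AffinityScheduling

/-! ## Markov jump processes and stochastic dominance of processes -/

/-- The history `σ(X s : s ≤ t)` of a process, as a filtration. -/
def history {Ω E : Type*} [mΩ : MeasurableSpace Ω] [mE : MeasurableSpace E]
    (X : ℝ≥0 → Ω → E) (hX : ∀ t, Measurable (X t)) : Filtration ℝ≥0 mΩ where
  seq t := ⨆ s : Set.Iic t, mE.comap (X s)
  mono' := fun _ t hst => iSup_le fun u =>
    le_iSup (fun s : Set.Iic t => mE.comap (X s)) ⟨u.1, u.2.trans hst⟩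
  le' := fun _ => iSup_le fun u => (hX u).comap_le

/-- The path `x` is right-continuous for the discrete topology of the state space: at every time
it stays constant for some positive amount of time. -/
def RightContinuousPath {E : Type*} (x : ℝ≥0 → E) : Prop :=
  ∀ t, ∀ᶠ s in 𝓝[>] t, x s = x t

/-- `X` is a time-homogeneous Markov jump process with generator `L`
(`L f x = ∑ y, q x y * (f y - f x)` for the jump rates `q`), formulated as the martingale problem
for `L` with right-continuous paths in a discrete state space. It is used only for generators with
bounded jump rates, for which the law of the process is determined by `L` and the law of `X 0`. -/
structure IsMarkovJumpProcess {Ω E : Type*} [MeasurableSpace Ω] [MeasurableSpace E]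
    (L : (E → ℝ) → E → ℝ) (P : Measure Ω) (X : ℝ≥0 → Ω → E) : Prop where
  measurable : ∀ t, Measurable (X t)
  rightContinuous : ∀ ω, RightContinuousPath fun t => X t ω
  martingale : ∀ f : E → ℝ, (∃ C, ∀ x, |f x| ≤ C) →
    Martingale (fun t ω => f (X t ω) - ∫ u in (0 : ℝ)..t, L f (X u.toNNReal ω))
      (history X measurable) P

/-- Stochastic dominance `{X t}_{t ≥ 0} ≤_st {Y t}_{t ≥ 0}` of processes with right-continuous
paths in a discrete ordered space: there are processes `X'`, `Y'` with right-continuous paths on a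
joint probability space such that `X'` has the law of `X` and `Y'` has the law of `Y` (as
processes), and almost surely `X' t ≤ Y' t` at all times `t`. -/
def ProcessStochLE {Ω₁ Ω₂ : Type*} {S : Type} [MeasurableSpace Ω₁] [MeasurableSpace Ω₂]
    [MeasurableSpace S] [Preorder S] (P₁ : Measure Ω₁) (P₂ : Measure Ω₂)
    (X : ℝ≥0 → Ω₁ → S) (Y : ℝ≥0 → Ω₂ → S) : Prop :=
  ∃ (Ω : Type) (_ : MeasurableSpace Ω) (P : Measure Ω) (_ : IsProbabilityMeasure P)
    (X' Y' : ℝ≥0 → Ω → S),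
    IdentDistrib (fun ω t => X' t ω) (fun ω t => X t ω) P P₁ ∧
    IdentDistrib (fun ω t => Y' t ω) (fun ω t => Y t ω) P P₂ ∧
    (∀ᵐ ω ∂P, RightContinuousPath (fun t => X' t ω) ∧ RightContinuousPath (fun t => Y' t ω)) ∧
    ∀ᵐ ω ∂P, ∀ t, X' t ω ≤ Y' t ω

/-! ## Occupancy variables -/

/-- The number of servers with at least `i` jobs, for the queue lengths `q`. -/
def numAtLeast {N : ℕ} (q : Fin N → ℕ) (i : ℕ) : ℕ :=
  (Finset.univ.filter fun n => i ≤ q n).card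

/-- The tail sums `∑_{i ≥ m} numAtLeast q i`, for `m ≥ 1`. -/
def tailSum {N : ℕ} (q : Fin N → ℕ) (m : ℕ+) : ℕ :=
  ∑' j : ℕ, numAtLeast q ((m : ℕ) + j)

/-- Only finitely many terms of a tail sum are nonzero. -/
theorem summable_numAtLeast {N : ℕ} (q : Fin N → ℕ) (m : ℕ+) :
    Summable fun j : ℕ => numAtLeast q ((m : ℕ) + j) := by
  refine summable_of_ne_finset_zero (s := Finset.range (∑ n, q n + 1)) fun j hj => ?_
  rw [Finset.mem_range, not_lt] at hj
  rw [numAtLeast, Finset.card_eq_zero, Finset.filter_eq_empty_iff]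
  intro n _ h
  have := Finset.single_le_sum (fun i _ => Nat.zero_le (q i)) (Finset.mem_univ n)
  omega

/-! ## The graph model under the affinity-scheduling policy -/

/-- Configurations: the numbers (type I jobs, type II jobs) at each of the `N` servers. -/
abbrev AffState (N : ℕ) : Type := Fin N → ℕ × ℕ

/-- The numbers of type I jobs at the servers. -/
def typeI {N : ℕ} (x : AffState N) : Fin N → ℕ := fun n => (x n).1

/-- The primary selection of a job arriving at `v`: the server `v` and its neighbours. -/
def primary {N : ℕ} (G : SimpleGraph (Fin N)) (v : Fin N) : Set (Fin N) :=
  insert v (G.neighborSet v)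

/-- A server is idle if it holds no job of either type. -/
def IsIdle {N : ℕ} (x : AffState N) (n : Fin N) : Prop := (x n).1 = 0 ∧ (x n).2 = 0

/-- In configuration `x`, the allocation strategy can send a job with primary selection
`primary G v` to server `n`:
1. to an idle primary server, if there is one;
2. otherwise to an idle secondary server, if there is one;
3. otherwise to a primary server with the smallest number of type I jobs, among these to one with
the smallest number of type II jobs. -/
def MayAllocate {N : ℕ} (G : SimpleGraph (Fin N)) (v : Fin N) (x : AffState N) (n : Fin N) :
    Prop :=
  (n ∈ primary G v ∧ IsIdle x n) ∨
  ((∀ m ∈ primary G v, ¬ IsIdle x m) ∧ n ∉ primary G v ∧ IsIdle x n) ∨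
  ((∀ m, ¬ IsIdle x m) ∧ n ∈ primary G v ∧
    ∀ m ∈ primary G v, (x n).1 < (x m).1 ∨ ((x n).1 = (x m).1 ∧ (x n).2 ≤ (x m).2))

/-- A version of the allocation strategy: the remaining ties are broken by an arbitrary, possibly
randomized, choice. `prob v x n` is the probability that a job arriving at `v` in configuration
`x` is sent to server `n`. -/
structure AffinityPolicy {N : ℕ} (G : SimpleGraph (Fin N)) where
  prob : Fin N → AffState N → PMF (Fin N)
  mayAllocate : ∀ v x n, n ∈ (prob v x).support → MayAllocate G v x n

open Classical in
/-- The configuration after a job arriving at `v` has been sent to server `n`; it becomes a type I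
job if `n` is a primary server, and a type II job if `n` is a secondary server. -/
def affArrival {N : ℕ} (G : SimpleGraph (Fin N)) (v : Fin N) (x : AffState N) (n : Fin N) :
    AffState N :=
  Function.update x n
    (if n ∈ primary G v then ((x n).1 + 1, (x n).2) else ((x n).1, (x n).2 + 1))

/-- The service rate at a server: type I jobs have preemptive priority. -/
def affServiceRate {N : ℕ} (μ₁ μ₂ : ℝ) (x : AffState N) (n : Fin N) : ℝ :=
  if 0 < (x n).1 then μ₁ else if 0 < (x n).2 then μ₂ else 0

/-- The configuration after a service completion at server `n`. -/
def affDeparture {N : ℕ} (x : AffState N) (n : Fin N) : AffState N :=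
  Function.update x n
    (if 0 < (x n).1 then ((x n).1 - 1, (x n).2) else ((x n).1, (x n).2 - 1))

/-- The generator of the graph model: jobs arrive at each vertex (that is, to each closed
neighbourhood) at rate `lam`. -/
def affGenerator {N : ℕ} (G : SimpleGraph (Fin N)) (pol : AffinityPolicy G) (lam μ₁ μ₂ : ℝ)
    (f : AffState N → ℝ) (x : AffState N) : ℝ :=
  (∑ v, ∑ n, lam * (pol.prob v x n).toReal * (f (affArrival G v x n) - f x)) +
    ∑ n, affServiceRate μ₁ μ₂ x n * (f (affDeparture x n) - f x)

/-! ## The reference system under MJSQ(k) -/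

/-- Configurations of the reference system: the numbers of jobs at the servers. -/
abbrev RefState (N : ℕ) : Type := Fin N → ℕ

/-- Server `n` has the `(k+1)`-th smallest queue length (counted with multiplicity). -/
def HasOrderedLength {N : ℕ} (k : ℕ) (y : RefState N) (n : Fin N) : Prop :=
  (Finset.univ.filter fun m => y m < y n).card ≤ k ∧
    k < (Finset.univ.filter fun m => y m ≤ y n).card

/-- A version of MJSQ(`k`): each job is sent to a server with the `(k+1)`-th smallest queue
length, where ties are broken by an arbitrary, possibly randomized, choice. -/
structure MJSQPolicy (N k : ℕ) where
  prob : RefState N → PMF (Fin N)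
  hasOrderedLength : ∀ y n, n ∈ (prob y).support → HasOrderedLength k y n

/-- The generator of the reference system: jobs arrive at total rate `lam * N`, and each of the
`N` servers works at rate `μ₁` while it has jobs. -/
def refGenerator {N k : ℕ} (pol : MJSQPolicy N k) (lam μ₁ : ℝ)
    (f : RefState N → ℝ) (y : RefState N) : ℝ :=
  (∑ n, lam * N * (pol.prob y n).toReal * (f (Function.update y n (y n + 1)) - f y)) +
    ∑ n, (if 0 < y n then μ₁ else 0) * (f (Function.update y n (y n - 1)) - f y)

/-- The laws `ν` and `ρ` of the initial configurations can be coupled such that the tail sums of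
type I jobs are almost surely at most those of the reference system (for deterministic initial
configurations: the tail sums satisfy this inequality). -/
def InitiallyOrdered {N : ℕ} (ν : Measure (AffState N)) (ρ : Measure (RefState N)) : Prop :=
  ∃ γ : Measure (AffState N × RefState N), γ.map Prod.fst = ν ∧ γ.map Prod.snd = ρ ∧
    ∀ᵐ p ∂γ, ∀ m : ℕ+, tailSum (typeI p.1) m ≤ tailSum p.2 m

end AffinityScheduling

end

namespace AffinityScheduling

/-! ## Ordered tail sums are preserved by coupled transitions -/

/-! Both systems are run on one clock of rate `N * (lam + μ₁)` (uniformization). Each ring carries a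
uniform index in `Fin N` and a coin that decides between an arrival (at that vertex) and a departure
(in each system, from the server of that rank by type I jobs or queue length). A second coin thins
the departures of type II jobs from rate `μ₁` to `μ₂`; it never affects type I jobs.

Every such event preserves weak majorization `TailLE`. A tail sum at level `c` is the number of
servers at level `c` plus the tail sum at `c + 1`, so an inequality at a neighbouring level plus a
comparison of server counts yields the strict inequality needed when only one side moves
unfavourably. For departures the counts come from equality of ranks (`TailLE.departure`). For
arrivals, a type I job joining a busy server finds all primary servers, at least `N - k` of them, at
least as loaded, while MJSQ(`k`) joins a queue such that at least `k + 1` servers are no longer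
(`TailLE.arrival`, `TailLE.affArrival`).

The given processes are arbitrary solutions of martingale problems, so they must be matched in law
with the constructed ones. For bounded generators the martingale problem gives a linear Volterra
equation for the conditional expectations, whose only solution is the exponential semigroup
(`IsMarkovJumpProcess.setIntegral_eq_evolution`). For the constructed process, conditioning on the
first ring gives a renewal equation which the semigroup also solves; uniqueness yields its Markov
property (`real_markov`). Thus both have the same finite-dimensional distributions, hence the same
law (`IsMarkovJumpProcess.identDistrib_jumpProcess`), and the pathwise order of the coupling is the
stochastic order. -/

theorem tailSum_eq_sum {N : ℕ} (q : Fin N → ℕ) (m : ℕ+) :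
    tailSum q m = ∑ n, (q n + 1 - (m : ℕ)) := by
  -- Exchange the sums: server `n` counts once for every level `i` with `m ≤ i ≤ q n`, and truncated
  -- subtraction gives 0 if there is none.
  have key (n : Fin N) : HasSum (fun j : ℕ => if (m : ℕ) + j ≤ q n then 1 else 0)
      (q n + 1 - (m : ℕ)) := by
    have h := hasSum_sum_of_ne_finset_zero
      (L := SummationFilter.unconditional ℕ) (f := fun j : ℕ => if (m : ℕ) + j ≤ q n then 1 else 0)
      (s := Finset.range (q n + 1 - (m : ℕ))) (fun j hj => by
        rw [Finset.mem_range, not_lt] at hj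
        exact if_neg (by omega))
    convert h using 1
    rw [Finset.sum_congr rfl (g := fun _ => 1)
      (fun j hj => if_pos (by rw [Finset.mem_range] at hj; omega))]
    simp
  have h := hasSum_sum (s := Finset.univ) fun n _ => key n
  rw [← h.tsum_eq, tailSum]
  exact tsum_congr fun j => by rw [numAtLeast, Finset.card_filter]

theorem sum_excess_eq {N : ℕ} (q : Fin N → ℕ) (c : ℕ) :
    ∑ n, (q n + 1 - c) = numAtLeast q c + ∑ n, (q n + 1 - (c + 1)) := by
  rw [numAtLeast, Finset.card_filter, ← Finset.sum_add_distrib]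
  refine Finset.sum_congr rfl fun n _ => ?_
  split_ifs <;> omega

theorem sum_excess_update_succ {N : ℕ} (q : Fin N → ℕ) (n : Fin N) (c : ℕ) :
    ∑ i, (Function.update q n (q n + 1) i + 1 - c) =
      ∑ i, (q i + 1 - c) + if c ≤ q n + 1 then 1 else 0 := by
  rw [← Finset.add_sum_erase _ _ (Finset.mem_univ n),
    ← Finset.add_sum_erase _ (fun i => q i + 1 - c) (Finset.mem_univ n),
    Finset.sum_congr rfl (s₁ := Finset.univ.erase n) (g := fun i => q i + 1 - c)
      (fun i hi => by rw [Function.update_of_ne (Finset.ne_of_mem_erase hi)])]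
  rw [Function.update_self]
  split_ifs <;> omega

/-- The bound `1 ≤ c` makes the formula correct for an empty server, where the truncated departure
changes nothing. -/
theorem sum_excess_update_pred {N : ℕ} (q : Fin N → ℕ) (n : Fin N) {c : ℕ} (hc : 1 ≤ c) :
    ∑ i, (Function.update q n (q n - 1) i + 1 - c) + (if c ≤ q n then 1 else 0) =
      ∑ i, (q i + 1 - c) := by
  rw [← Finset.add_sum_erase _ _ (Finset.mem_univ n),
    ← Finset.add_sum_erase _ (fun i => q i + 1 - c) (Finset.mem_univ n),
    Finset.sum_congr rfl (s₁ := Finset.univ.erase n) (g := fun i => q i + 1 - c)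
      (fun i hi => by rw [Function.update_of_ne (Finset.ne_of_mem_erase hi)])]
  rw [Function.update_self]
  split_ifs <;> omega

/-- Weak majorization of queue lengths, in terms of all tail sums. -/
def TailLE {N : ℕ} (q r : Fin N → ℕ) : Prop :=
  ∀ c : ℕ, 1 ≤ c → ∑ n, (q n + 1 - c) ≤ ∑ n, (r n + 1 - c)

theorem tailLE_iff {N : ℕ} (q r : Fin N → ℕ) :
    TailLE q r ↔ ∀ m : ℕ+, tailSum q m ≤ tailSum r m := by
  simp only [tailSum_eq_sum]
  exact ⟨fun h m => h m m.pos, fun h c hc => h ⟨c, hc⟩⟩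

/-- With ranks counted from 0 in increasing order, the `N - j` servers of rank `j` or more all reach
`c`. -/
theorem le_numAtLeast_of_monotone {N : ℕ} {q : Fin N → ℕ} {σ : Equiv.Perm (Fin N)}
    (hσ : Monotone (q ∘ σ)) {c : ℕ} {j : Fin N} (h : c ≤ q (σ j)) :
    N - j ≤ numAtLeast q c := by
  have : (Finset.Ici j).map σ.toEmbedding ⊆ Finset.univ.filter fun n => c ≤ q n := by
    intro n hn
    simp only [Finset.mem_map, Finset.mem_Ici, Equiv.coe_toEmbedding] at hn
    obtain ⟨i, hi, rfl⟩ := hn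
    simpa using h.trans (hσ hi)
  have h2 := Finset.card_le_card this
  rwa [Finset.card_map, Fin.card_Ici] at h2

/-- Only ranks strictly above `j` can reach `c`. The resulting bound is one less than in
`le_numAtLeast_of_monotone`, which is the gain that departures need. -/
theorem numAtLeast_le_of_monotone {N : ℕ} {q : Fin N → ℕ} {σ : Equiv.Perm (Fin N)}
    (hσ : Monotone (q ∘ σ)) {c : ℕ} {j : Fin N} (h : q (σ j) < c) :
    numAtLeast q c ≤ N - 1 - j := by
  have : (Finset.univ.filter fun n => c ≤ q n) ⊆ (Finset.Ioi j).map σ.toEmbedding := by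
    intro n hn
    simp only [Finset.mem_filter, Finset.mem_univ, true_and] at hn
    simp only [Finset.mem_map, Finset.mem_Ioi, Equiv.coe_toEmbedding]
    refine ⟨σ.symm n, ?_, by simp⟩
    by_contra hlt
    have := hσ (not_lt.1 hlt)
    simp at this
    omega
  have h2 := Finset.card_le_card this
  rwa [Finset.card_map, Fin.card_Ioi] at h2

/-- Departures from the servers of the same rank preserve the order. -/
theorem TailLE.departure {N : ℕ} {q r : Fin N → ℕ} (h : TailLE q r) {σ τ : Equiv.Perm (Fin N)}
    (hσ : Monotone (q ∘ σ)) (hτ : Monotone (r ∘ τ)) (j : Fin N) :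
    TailLE (Function.update q (σ j) (q (σ j) - 1)) (Function.update r (τ j) (r (τ j) - 1)) := by
  intro c hc
  have hq := sum_excess_update_pred q (σ j) hc
  have hr := sum_excess_update_pred r (τ j) hc
  have hqc := sum_excess_eq q c
  have hrc := sum_excess_eq r c
  have h1 := h c hc
  have h2 := h (c + 1) (by omega)
  have hj := j.2
  by_cases hA : c ≤ r (τ j)
  · by_cases hB : c ≤ q (σ j)
    · rw [if_pos hA] at hr
      rw [if_pos hB] at hq
      omega
    -- The critical case: only `r` loses a unit at level `c`. Then at least `N - j` servers of `r`
    -- but at most `N - 1 - j` of `q` reach `c`; with the inequality at `c + 1`, the one at `c` was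
    -- strict.
    · have h3 := le_numAtLeast_of_monotone hτ hA
      have h4 := numAtLeast_le_of_monotone hσ (not_le.1 hB)
      rw [if_pos hA] at hr
      rw [if_neg hB] at hq
      omega
  · rw [if_neg hA] at hr
    omega

theorem TailLE.update_succ_right {N : ℕ} {q r : Fin N → ℕ} (h : TailLE q r) (n : Fin N) :
    TailLE q (Function.update r n (r n + 1)) := by
  intro c hc
  rw [sum_excess_update_succ]
  exact (h c hc).trans (Nat.le_add_right _ _)

/-- Arrivals preserve the order if the first one is at a server which is empty or exceeded by at
most `k` other servers, and the second one obeys MJSQ(`k`). -/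
theorem TailLE.arrival {N k : ℕ} {q r : Fin N → ℕ} (h : TailLE q r) {n n' : Fin N}
    (hn : 0 < q n → N - k ≤ numAtLeast q (q n)) (hn' : HasOrderedLength k r n') :
    TailLE (Function.update q n (q n + 1)) (Function.update r n' (r n' + 1)) := by
  intro c hc
  rw [sum_excess_update_succ, sum_excess_update_succ]
  have h1 := h c hc
  split_ifs with hA hB
  · omega
  -- The critical case: only `q` gains at level `c`. Here `r n' < d`, so `d ≥ 1` and `q n > 0`. At
  -- least `N - k` servers of `q` reach `d`, but fewer of `r` do, so the inequality at `d` is strict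
  -- at `d + 1`.
  · obtain ⟨d, rfl⟩ : ∃ d, c = d + 1 := ⟨c - 1, by omega⟩
    have h2 := h d (by omega)
    have hqd := sum_excess_eq q d
    have hrd := sum_excess_eq r d
    have h3 : N - k ≤ numAtLeast q d := by
      refine (hn (by omega)).trans (Finset.card_le_card fun m hm => ?_)
      simp only [Finset.mem_filter, Finset.mem_univ, true_and] at hm ⊢
      omega
    have h4 : numAtLeast r d + (Finset.univ.filter fun m => r m ≤ r n').card ≤ N := by
      rw [numAtLeast, ← Finset.card_union_of_disjoint]
      · exact (Finset.card_le_univ _).trans (by simp)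
      · rw [Finset.disjoint_filter]
        intro m _ h5
        omega
    have h5 := hn'.2
    omega
  · omega
  · omega

/-! ### Type I jobs under arrivals and departures in the graph model -/

/-- A closed neighbourhood has one vertex more than the degree of its centre. This is where the
degree condition produces `N - k` loaded servers. -/
theorem card_le_numAtLeast_primary {N : ℕ} (G : SimpleGraph (Fin N)) [DecidableRel G.Adj]
    (v : Fin N) (q : Fin N → ℕ) (c : ℕ) (h : ∀ m ∈ primary G v, c ≤ q m) :
    G.minDegree + 1 ≤ numAtLeast q c := by
  have : insert v (G.neighborFinset v) ⊆ Finset.univ.filter fun n => c ≤ q n := by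
    intro m hm
    simp only [Finset.mem_filter, Finset.mem_univ, true_and]
    exact h m (by simpa [primary] using hm)
  refine le_trans ?_ (Finset.card_le_card this)
  rw [Finset.card_insert_of_notMem (by simp)]
  exact Nat.succ_le_succ (G.minDegree_le_degree v)

theorem typeI_affArrival_of_mem {N : ℕ} {G : SimpleGraph (Fin N)} {v n : Fin N}
    (h : n ∈ primary G v) (x : AffState N) :
    typeI (affArrival G v x n) = Function.update (typeI x) n (typeI x n + 1) := by
  funext i
  rcases eq_or_ne i n with rfl | hi <;> simp [typeI, affArrival, *]

theorem typeI_affArrival_of_notMem {N : ℕ} {G : SimpleGraph (Fin N)} {v n : Fin N}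
    (h : n ∉ primary G v) (x : AffState N) :
    typeI (affArrival G v x n) = typeI x := by
  funext i
  rcases eq_or_ne i n with rfl | hi <;> simp [typeI, affArrival, *]

/-- One formula covers both job types: a type II job leaves only if there is no type I job, and then
`0 - 1 = 0`. -/
theorem typeI_affDeparture {N : ℕ} (x : AffState N) (n : Fin N) :
    typeI (affDeparture x n) = Function.update (typeI x) n (typeI x n - 1) := by
  funext i
  rcases eq_or_ne i n with rfl | hi
  · by_cases h : 0 < (x i).1
    · simp [typeI, affDeparture, h]
    · simp only [not_lt, Nat.le_zero] at h
      simp [typeI, affDeparture, h]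
  · simp [typeI, affDeparture, hi]

/-- A simultaneous arrival preserves the order. -/
theorem TailLE.affArrival {N k : ℕ} {G : SimpleGraph (Fin N)} [DecidableRel G.Adj]
    (hG : N - k - 1 ≤ G.minDegree) {x : AffState N} {r : RefState N} (h : TailLE (typeI x) r)
    {v n n' : Fin N} (hn : MayAllocate G v x n) (hn' : HasOrderedLength k r n') :
    TailLE (typeI (affArrival G v x n)) (Function.update r n' (r n' + 1)) := by
  by_cases hp : n ∈ primary G v
  · rw [typeI_affArrival_of_mem hp]
    refine h.arrival (fun h0 => ?_) hn'
    have h0' : 0 < (x n).1 := h0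
    -- A primary server holding a type I job can be chosen only by the third rule, which makes it a
    -- minimum over the closed neighbourhood.
    rcases hn with ⟨_, h1⟩ | ⟨_, h1, _⟩ | ⟨_, _, h1⟩
    · rw [h1.1] at h0'
      exact absurd h0' (lt_irrefl _)
    · exact absurd hp h1
    · have := card_le_numAtLeast_primary G v (typeI x) (typeI x n) fun m hm => by
        rcases h1 m hm with h2 | h2
        · exact h2.le
        · exact h2.1.le
      omega
  · rw [typeI_affArrival_of_notMem hp]
    exact h.update_succ_right n'

/-! ## Uniqueness for linear evolution equations -/

/-- A bounded family of functionals with `D t f = ∫ r in 0..t, D r (B f)` vanishes. -/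
theorem eq_zero_of_eq_integral {V : Type*} [NormedAddCommGroup V] [NormedSpace ℝ V]
    (B : V →L[ℝ] V) {D : ℝ → V → ℝ} {C T : ℝ} (hC0 : 0 ≤ C)
    (hC : ∀ t ∈ Set.Icc 0 T, ∀ f, |D t f| ≤ C * ‖f‖)
    (hD : ∀ t ∈ Set.Icc 0 T, ∀ f, D t f = ∫ r in (0 : ℝ)..t, D r (B f))
    {t : ℝ} (ht : t ∈ Set.Icc 0 T) (f : V) : D t f = 0 := by
  -- Iterating the integral equation `n` times gains a factor `t ^ n / n!`, which beats `‖B‖ ^ n`.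
  have key : ∀ n : ℕ, ∀ t ∈ Set.Icc 0 T, ∀ f,
      |D t f| ≤ C * ‖B‖ ^ n * ‖f‖ * (t ^ n / (n.factorial : ℝ)) := by
    intro n
    induction n with
    | zero => intro t ht f; simpa using hC t ht f
    | succ n ih =>
      intro t ht f
      rw [hD t ht f]
      have h1 : ‖∫ r in (0 : ℝ)..t, D r (B f)‖ ≤
          ∫ r in (0 : ℝ)..t, C * ‖B‖ ^ (n + 1) * ‖f‖ / (n.factorial : ℝ) * r ^ n := by
        refine intervalIntegral.norm_integral_le_of_norm_le ht.1 (ae_of_all _ fun r hr => ?_)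
          (Continuous.intervalIntegrable (by fun_prop) _ _)
        have hr' : r ∈ Set.Icc 0 T := ⟨hr.1.le, hr.2.trans ht.2⟩
        refine (ih r hr' (B f)).trans ?_
        have h2 : C * ‖B‖ ^ n * ‖B f‖ ≤ C * ‖B‖ ^ (n + 1) * ‖f‖ := by
          rw [pow_succ, ← mul_assoc, mul_assoc (C * ‖B‖ ^ n)]
          gcongr
          exact B.le_opNorm f
        calc _ ≤ C * ‖B‖ ^ (n + 1) * ‖f‖ * (r ^ n / (n.factorial : ℝ)) := by
              have := hr'.1
              gcongr
          _ = _ := by ring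
      refine h1.trans (le_of_eq ?_)
      rw [intervalIntegral.integral_const_mul, integral_pow, Nat.factorial_succ]
      have : (n.factorial : ℝ) ≠ 0 := by positivity
      push_cast
      field_simp
      simp
  have hlim : Tendsto (fun n : ℕ => C * ‖f‖ * ((‖B‖ * t) ^ n / (n.factorial : ℝ))) atTop (𝓝 0) := by
    simpa using (FloorSemiring.tendsto_pow_div_factorial_atTop (‖B‖ * t)).const_mul (C * ‖f‖)
  refine abs_nonpos_iff.1 (ge_of_tendsto' hlim fun n => (key n t ht f).trans (le_of_eq ?_))
  rw [mul_pow]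
  ring

/-- The semigroup of operators generated by `B`. -/
noncomputable def evolution {V : Type*} [NormedAddCommGroup V] [NormedSpace ℝ V]
    (B : V →L[ℝ] V) (t : ℝ) : V →L[ℝ] V :=
  NormedSpace.exp (t • B)

section evolution

variable {V : Type*} [NormedAddCommGroup V] [NormedSpace ℝ V] (B : V →L[ℝ] V)

theorem evolution_zero : evolution B 0 = 1 := by
  simp [evolution]

variable [CompleteSpace V]

theorem hasDerivAt_apply_evolution (φ : V →L[ℝ] ℝ) (f : V) (r : ℝ) :
    HasDerivAt (fun r : ℝ => φ (evolution B r f)) (φ (evolution B r (B f))) r :=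
  φ.hasFDerivAt.comp_hasDerivAt r
    (((ContinuousLinearMap.apply ℝ V f).hasFDerivAt).comp_hasDerivAt r
      (hasDerivAt_exp_smul_const (𝕂 := ℝ) B r))

/-- `B` commutes with its semigroup. The forward form `hasDerivAt_apply_evolution` matches the
martingale problem; this backward form serves the renewal equation, where the first step is taken
first. -/
theorem hasDerivAt_apply_evolution' (φ : V →L[ℝ] ℝ) (f : V) (r : ℝ) :
    HasDerivAt (fun r : ℝ => φ (evolution B r f)) (φ (B (evolution B r f))) r :=
  φ.hasFDerivAt.comp_hasDerivAt r
    (((ContinuousLinearMap.apply ℝ V f).hasFDerivAt).comp_hasDerivAt r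
      (hasDerivAt_exp_smul_const' (𝕂 := ℝ) B r))

theorem continuous_apply_evolution (φ : V →L[ℝ] ℝ) (f : V) :
    Continuous fun r : ℝ => φ (evolution B r f) :=
  continuous_iff_continuousAt.2 fun r => (hasDerivAt_apply_evolution B φ f r).continuousAt

theorem exists_norm_evolution_le (T : ℝ) :
    ∃ C, ∀ r ∈ Set.Icc 0 T, ‖evolution B r‖ ≤ C := by
  have hcont : Continuous fun r : ℝ => evolution B r :=
    continuous_iff_continuousAt.2 fun r =>
      (hasDerivAt_exp_smul_const (𝕂 := ℝ) B r).continuousAt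
  exact isCompact_Icc.exists_bound_of_continuousOn hcont.continuousOn

theorem apply_evolution_eq (φ : V →L[ℝ] ℝ) (f : V) (t : ℝ) :
    φ (evolution B t f) = φ f + ∫ r in (0 : ℝ)..t, φ (evolution B r (B f)) := by
  rw [intervalIntegral.integral_eq_sub_of_hasDerivAt
    (fun r _ => hasDerivAt_apply_evolution B φ f r)
    ((continuous_apply_evolution B φ (B f)).intervalIntegrable _ _)]
  simp [evolution_zero]

end evolution

/-! ## Finite-dimensional distributions from the martingale problem -/

open BoundedContinuousFunction in
/-- The indicator function of a point of a discrete space. -/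
noncomputable def pointIndicator {E : Type*} [TopologicalSpace E] [DiscreteTopology E] (y : E) :
    E →ᵇ ℝ :=
  ofNormedAddCommGroupDiscrete (Set.indicator {y} 1) 1 fun x => by
    by_cases h : x = y <;> simp [h]

open BoundedContinuousFunction in
theorem pointIndicator_apply {E : Type*} [TopologicalSpace E] [DiscreteTopology E] (y x : E) :
    pointIndicator y x = Set.indicator {y} 1 x := rfl

open BoundedContinuousFunction in
/-- The transition function of the semigroup generated by `B`. -/
noncomputable def transition {E : Type*} [TopologicalSpace E] [DiscreteTopology E]
    (B : (E →ᵇ ℝ) →L[ℝ] (E →ᵇ ℝ)) (t : ℝ≥0) (x y : E) : ℝ :=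
  evolution B t (pointIndicator y) x

open BoundedContinuousFunction in
/-- The product of the transition probabilities along the states `e t` at the listed times. -/
noncomputable def pathWeight {E : Type*} [TopologicalSpace E] [DiscreteTopology E]
    (B : (E →ᵇ ℝ) →L[ℝ] (E →ᵇ ℝ)) (e : ℝ≥0 → E) : ℝ≥0 → List ℝ≥0 → ℝ
  | _, [] => 1
  | s, t :: ts => transition B (t - s) (e s) (e t) * pathWeight B e t ts

/-- Joint measurability is what Fubini needs. Time `u` is replaced by the next grid point of mesh `1
/ (n + 1)` strictly to its right; right-continuity in the discrete sense makes the approximation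
eventually exact. -/
theorem measurable_uncurry_of_rightContinuousPath {Ω E : Type*} [MeasurableSpace Ω]
    [MeasurableSpace E] [DiscreteMeasurableSpace E] {X : ℝ≥0 → Ω → E} (hX : ∀ t, Measurable (X t))
    (hr : ∀ ω, RightContinuousPath fun t => X t ω) (f : E → ℝ) :
    Measurable fun p : ℝ≥0 × Ω => f (X p.1 p.2) := by
  obtain ⟨g, hgdef⟩ : ∃ g : ℕ → ℕ → Ω → ℝ,
      ∀ n m ω, g n m ω = f (X ((m + 1 : ℝ≥0) / (n + 1 : ℝ≥0)) ω) := ⟨_, fun _ _ _ => rfl⟩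
  have hg (n : ℕ) : Measurable fun p : ℕ × Ω => g n p.1 p.2 :=
    measurable_from_prod_countable_right (f := fun p : ℕ × Ω => g n p.1 p.2) fun m => by
      simp only [hgdef]
      change Measurable fun ω => f (X ((m + 1 : ℝ≥0) / (n + 1 : ℝ≥0)) ω)
      exact (Measurable.of_discrete (f := f)).comp (hX _)
  refine measurable_of_tendsto_metrizable
    (f := fun (n : ℕ) (p : ℝ≥0 × Ω) => g n ⌊(n + 1 : ℝ≥0) * p.1⌋₊ p.2) (fun n => ?_) ?_
  · have h1 : Measurable fun p : ℝ≥0 × Ω => (⌊(n + 1 : ℝ≥0) * p.1⌋₊, p.2) :=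
      (Nat.measurable_floor.comp (measurable_fst.const_mul _)).prodMk measurable_snd
    exact (hg n).comp h1
  · rw [tendsto_pi_nhds]
    rintro ⟨u, ω⟩
    refine tendsto_const_nhds.congr' ?_
    have hlim : Tendsto (fun n : ℕ => ((⌊(n + 1 : ℝ≥0) * u⌋₊ + 1 : ℝ≥0)) / (n + 1 : ℝ≥0)) atTop
        (𝓝[>] u) := by
      have hlt (n : ℕ) : u < ((⌊(n + 1 : ℝ≥0) * u⌋₊ + 1 : ℝ≥0)) / (n + 1 : ℝ≥0) := by
        rw [lt_div_iff₀ (by positivity), mul_comm]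
        exact Nat.lt_floor_add_one _
      refine tendsto_nhdsWithin_iff.2 ⟨?_, Eventually.of_forall hlt⟩
      refine tendsto_of_tendsto_of_tendsto_of_le_of_le tendsto_const_nhds
        (h := fun n : ℕ => u + 1 / (n + 1 : ℝ≥0)) ?_ (fun n => (hlt n).le) fun n => ?_
      · simpa using tendsto_const_nhds.add (tendsto_one_div_add_atTop_nhds_zero_nat (𝕜 := ℝ≥0))
      · have h2 : (u + 1 / (n + 1 : ℝ≥0)) * (n + 1) = (n + 1) * u + 1 := by field_simp
        rw [div_le_iff₀ (by positivity)]
        refine le_of_le_of_eq ?_ h2.symm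
        gcongr
        exact Nat.floor_le (by positivity)
    filter_upwards [hlim.eventually (hr ω u)] with n hn
    rw [hgdef]
    exact congrArg f hn.symm

open BoundedContinuousFunction

theorem integrable_boundedFunction {Ω E : Type*} [MeasurableSpace Ω]
    [MeasurableSpace E] [DiscreteMeasurableSpace E] [TopologicalSpace E] {P : Measure Ω}
    [IsProbabilityMeasure P] {Z : Ω → E} (hZ : Measurable Z) (f : E →ᵇ ℝ) (A : Set Ω) :
    Integrable (fun ω => f (Z ω)) (P.restrict A) :=
  Integrable.of_bound ((Measurable.of_discrete (f := f)).comp hZ).aestronglyMeasurable ‖f‖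
    (ae_of_all _ fun _ => f.norm_coe_le_norm _)

theorem abs_setIntegral_le {Ω E : Type*} [MeasurableSpace Ω] [TopologicalSpace E] {P : Measure Ω}
    [IsProbabilityMeasure P] {Z : Ω → E} (f : E →ᵇ ℝ) (A : Set Ω) :
    |∫ ω in A, f (Z ω) ∂P| ≤ ‖f‖ := by
  have h := norm_integral_le_of_norm_le_const (μ := P.restrict A) (f := fun ω => f (Z ω)) (C := ‖f‖)
    (ae_of_all _ fun _ => f.norm_coe_le_norm _)
  refine h.trans ?_
  rw [measureReal_restrict_apply_univ]
  exact mul_le_of_le_one_right (norm_nonneg _) measureReal_le_one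

theorem measurableSet_history_of_le {Ω E : Type*} [MeasurableSpace Ω]
    [MeasurableSpace E] [DiscreteMeasurableSpace E] {X : ℝ≥0 → Ω → E} (hX : ∀ t, Measurable (X t)) {u s : ℝ≥0} (h : u ≤ s)
    (x : E) : MeasurableSet[history X hX s] {ω | X u ω = x} :=
  le_iSup (fun u : Set.Iic s => MeasurableSpace.comap (X u) inferInstance) ⟨u, h⟩ _
    ⟨{x}, .of_discrete, rfl⟩

/-- The martingale identity between `s` and `s + t` is integrated over an event of the history, and
Fubini moves the time integral outside. -/
theorem IsMarkovJumpProcess.setIntegral_eq_add {Ω E : Type*} [MeasurableSpace Ω]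
    [MeasurableSpace E] [DiscreteMeasurableSpace E] [TopologicalSpace E] {L : (E → ℝ) → E → ℝ}
    {P : Measure Ω} [IsProbabilityMeasure P] {X : ℝ≥0 → Ω → E} {B : (E →ᵇ ℝ) →L[ℝ] (E →ᵇ ℝ)}
    (hX : IsMarkovJumpProcess L P X)
    (hB : ∀ (f : E →ᵇ ℝ) x, L f x = B f x) {s : ℝ≥0} {A : Set Ω}
    (hA : MeasurableSet[history X hX.measurable s] A) (f : E →ᵇ ℝ) {t : ℝ} (ht : 0 ≤ t) :
    ∫ ω in A, f (X (s + t).toNNReal ω) ∂P = ∫ ω in A, f (X s ω) ∂P +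
      ∫ r in (0 : ℝ)..t, ∫ ω in A, B f (X (s + r).toNNReal ω) ∂P := by
  have hM := hX.martingale f ⟨‖f‖, fun x => f.norm_coe_le_norm x⟩
  have hL : L f = B f := funext (hB f)
  rw [hL] at hM
  have hm : Measurable fun p : ℝ × Ω => B f (X p.1.toNNReal p.2) :=
    (measurable_uncurry_of_rightContinuousPath hX.measurable hX.rightContinuous (B f)).comp
      (Measurable.prodMk (measurable_real_toNNReal.comp measurable_fst) measurable_snd)
  have hint (ω : Ω) (a b : ℝ) : IntervalIntegrable (fun u => B f (X u.toNNReal ω)) volume a b := by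
    refine intervalIntegrable_iff.2 (Measure.integrableOn_of_bounded (M := ‖B f‖) (by simp)
      (hm.comp measurable_prodMk_right).aestronglyMeasurable
      (ae_of_all _ fun _ => (B f).norm_coe_le_norm _))
  have hs : s ≤ (s + t).toNNReal := by
    rw [Real.le_toNNReal_iff_coe_le (by positivity)]
    linarith
  have heq := hM.setIntegral_eq hs hA
  -- The time integral is `f (X u)` minus the martingale, hence integrable.
  have hI (u : ℝ≥0) :
      Integrable (fun ω => ∫ u in (0 : ℝ)..u, B f (X u.toNNReal ω)) (P.restrict A) := by
    have h1 := (integrable_boundedFunction (P := P) (hX.measurable u) f A).sub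
      (hM.integrable u).restrict
    refine h1.congr (ae_of_all _ fun ω => ?_)
    simp
  rw [integral_sub (integrable_boundedFunction (hX.measurable _) f A) (hI _),
    integral_sub (integrable_boundedFunction (hX.measurable _) f A) (hI _),
    sub_eq_iff_eq_add] at heq
  have h2 : ∫ ω in A, (∫ u in (0 : ℝ)..(s + t).toNNReal, B f (X u.toNNReal ω)) ∂P -
      ∫ ω in A, (∫ u in (0 : ℝ)..s, B f (X u.toNNReal ω)) ∂P =
      ∫ r in (0 : ℝ)..t, ∫ ω in A, B f (X (s + r).toNNReal ω) ∂P := by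
    rw [← integral_sub (hI _) (hI _)]
    rw [intervalIntegral.integral_of_le ht, integral_integral_swap]
    · refine integral_congr_ae (ae_of_all _ fun ω => ?_)
      simp only
      rw [intervalIntegral.integral_interval_sub_left (hint _ _ _) (hint _ _ _),
        ← intervalIntegral.integral_of_le ht,
        intervalIntegral.integral_comp_add_left (fun u => B f (X u.toNNReal ω)),
        Real.coe_toNNReal _ (by positivity), add_zero]
    · refine Integrable.of_bound (C := ‖B f‖) ?_ (ae_of_all _ fun p => (B f).norm_coe_le_norm _)
      exact (hm.comp ((measurable_fst.const_add (s : ℝ)).prodMk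
        measurable_snd)).aestronglyMeasurable
  rw [← h2]
  linarith

section law

variable {Ω E : Type*} [MeasurableSpace Ω] [MeasurableSpace E] [DiscreteMeasurableSpace E]
  [TopologicalSpace E] {L : (E → ℝ) → E → ℝ} {P : Measure Ω}
  [IsProbabilityMeasure P] {X : ℝ≥0 → Ω → E} {B : (E →ᵇ ℝ) →L[ℝ] (E →ᵇ ℝ)}

/-- Integration of bounded functions of `Z` over the event `A`. -/
noncomputable def setExpectation (P : Measure Ω) [IsProbabilityMeasure P] {Z : Ω → E}
    (hZ : Measurable Z) (A : Set Ω) : (E →ᵇ ℝ) →L[ℝ] ℝ :=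
  LinearMap.mkContinuous
    { toFun := fun f => ∫ ω in A, f (Z ω) ∂P
      map_add' := fun f g => integral_add (integrable_boundedFunction hZ f A)
        (integrable_boundedFunction hZ g A)
      map_smul' := fun c f => integral_const_mul c _ } 1
    fun f => by simpa using abs_setIntegral_le f A

/-- The martingale problem determines the conditional law at later times. -/
theorem IsMarkovJumpProcess.setIntegral_eq_evolution (hX : IsMarkovJumpProcess L P X)
    (hB : ∀ (f : E →ᵇ ℝ) x, L f x = B f x) {s : ℝ≥0} {A : Set Ω}
    (hA : MeasurableSet[history X hX.measurable s] A) (f : E →ᵇ ℝ) (t : ℝ≥0) :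
    ∫ ω in A, f (X (s + t) ω) ∂P =
      ∫ ω in A, evolution B t f (X s ω) ∂P := by
  let φ := setExpectation P (hX.measurable s) A
  have hφ (f : E →ᵇ ℝ) : φ f = ∫ ω in A, f (X s ω) ∂P := rfl
  -- The defect between the true and the predicted expectation is a bounded functional obeying the
  -- homogeneous Volterra equation, so it vanishes.
  let D (r : ℝ) (f : E →ᵇ ℝ) : ℝ :=
    ∫ ω in A, f (X (s + r).toNNReal ω) ∂P - φ (evolution B r f)
  obtain ⟨C, hC⟩ : ∃ C, ∀ r ∈ Set.Icc 0 (t : ℝ), ‖evolution B r‖ ≤ C :=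
    exists_norm_evolution_le B t
  have hC0 : 0 ≤ C := (norm_nonneg _).trans (hC 0 ⟨le_rfl, t.2⟩)
  have hzero := eq_zero_of_eq_integral B (D := D) (C := 1 + C) (T := t) (by positivity)
    (fun r hr f => ?_) (fun r hr f => ?_) (t := t) ⟨t.2, le_rfl⟩ f
  · have h1 := sub_eq_zero.1 hzero
    rwa [hφ, ← NNReal.coe_add, Real.toNNReal_coe] at h1
  · refine (abs_sub _ _).trans ?_
    rw [add_mul, one_mul]
    refine add_le_add (abs_setIntegral_le f A) ?_
    refine (abs_setIntegral_le _ A).trans ((ContinuousLinearMap.le_opNorm _ f).trans ?_)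
    gcongr
    exact hC r hr
  · have h1 := hX.setIntegral_eq_add hB hA f hr.1
    have h2 := apply_evolution_eq B φ f r
    have hm : Measurable fun p : ℝ × Ω => B f (X p.1.toNNReal p.2) :=
      (measurable_uncurry_of_rightContinuousPath hX.measurable hX.rightContinuous (B f)).comp
        (Measurable.prodMk (measurable_real_toNNReal.comp measurable_fst) measurable_snd)
    have hi1 : IntervalIntegrable (fun r => ∫ ω in A, B f (X (s + r).toNNReal ω) ∂P)
        volume 0 r := by
      have h3 : StronglyMeasurable fun r : ℝ => ∫ ω in A, B f (X (s + r).toNNReal ω) ∂P := by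
        refine StronglyMeasurable.integral_prod_right'
          (f := fun p : ℝ × Ω => B f (X (s + p.1).toNNReal p.2)) ?_
        exact (hm.comp ((measurable_fst.const_add (s : ℝ)).prodMk
          measurable_snd)).stronglyMeasurable
      exact intervalIntegrable_iff.2 (Measure.integrableOn_of_bounded (M := ‖B f‖) (by simp)
        h3.aestronglyMeasurable (ae_of_all _ fun _ => abs_setIntegral_le _ A))
    have hi2 : IntervalIntegrable (fun r : ℝ => φ (evolution B r (B f)))
        volume 0 r := (continuous_apply_evolution B φ (B f)).intervalIntegrable _ _
    simp only [D]
    rw [intervalIntegral.integral_sub hi1 hi2, h1, h2, hφ]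
    ring

variable [DiscreteTopology E]

theorem IsMarkovJumpProcess.real_inter_eq (hX : IsMarkovJumpProcess L P X)
    (hB : ∀ (f : E →ᵇ ℝ) x, L f x = B f x) {s t : ℝ≥0} (hst : s ≤ t) {A : Set Ω}
    (hA : MeasurableSet[history X hX.measurable s] A) {x y : E} (hx : ∀ ω ∈ A, X s ω = x) :
    P.real (A ∩ {ω | X t ω = y}) = P.real A * transition B (t - s) x y := by
  have hA' : MeasurableSet A := (history X hX.measurable).le s _ hA
  have h := hX.setIntegral_eq_evolution hB hA (pointIndicator y) (t - s)
  rw [add_tsub_cancel_of_le hst] at h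
  have hy : MeasurableSet {ω | X t ω = y} := hX.measurable t (.of_discrete (s := {y}))
  have h1 : ∫ ω in A, pointIndicator y (X t ω) ∂P = P.real (A ∩ {ω | X t ω = y}) := by
    have : (fun ω => pointIndicator y (X t ω)) = Set.indicator {ω | X t ω = y} 1 := by
      funext ω
      rw [pointIndicator_apply]
      rfl
    rw [this, integral_indicator_one hy, measureReal_restrict_apply hy, Set.inter_comm]
  have h2 : ∫ ω in A, evolution B (t - s : ℝ≥0) (pointIndicator y) (X s ω) ∂P =
      ∫ ω in A, transition B (t - s) x y ∂P :=
    setIntegral_congr_fun hA' fun ω hω => by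
      rw [hx ω hω, transition]
  rw [← h1, h, h2, setIntegral_const, smul_eq_mul]

/-- Induction on the times. The event `A` is general because each step absorbs the newly observed
value into it, an event of the later history. -/
theorem IsMarkovJumpProcess.real_path_eq (hX : IsMarkovJumpProcess L P X)
    (hB : ∀ (f : E →ᵇ ℝ) x, L f x = B f x) (e : ℝ≥0 → E) (ts : List ℝ≥0) :
    ∀ {s : ℝ≥0} {A : Set Ω}, (s :: ts).Pairwise (· ≤ ·) →
      MeasurableSet[history X hX.measurable s] A → (∀ ω ∈ A, X s ω = e s) →
      P.real (A ∩ {ω | ∀ t ∈ ts, X t ω = e t}) = P.real A * pathWeight B e s ts := by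
  induction ts with
  | nil => intro s A _ _ _; simp [pathWeight]
  | cons t ts ih =>
    intro s A hp hA hx
    rw [List.pairwise_cons] at hp
    have hst : s ≤ t := hp.1 t (by simp)
    have h1 : A ∩ {ω | ∀ u ∈ t :: ts, X u ω = e u} =
        (A ∩ {ω | X t ω = e t}) ∩ {ω | ∀ u ∈ ts, X u ω = e u} := by
      ext ω
      simp [and_assoc]
    rw [h1, ih hp.2 (((history X hX.measurable).mono hst _ hA).inter
      (measurableSet_history_of_le _ le_rfl _)) fun ω hω => hω.2, hX.real_inter_eq hB hst hA hx,
      pathWeight]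
    ring

end law

/-! ## Random dynamical systems at exponential times -/

/-- The sequence with first term `a` and remaining terms `ω`. -/
def consSeq {A : Type*} (a : A) (ω : ℕ → A) : ℕ → A
  | 0 => a
  | n + 1 => ω n

theorem measurable_consSeq {A : Type*} [MeasurableSpace A] :
    Measurable fun p : A × (ℕ → A) => consSeq p.1 p.2 := by
  refine measurable_pi_lambda _ fun n => ?_
  cases n with
  | zero => exact measurable_fst
  | succ n => exact (measurable_pi_apply n).comp measurable_snd

/-- The first term of an i.i.d. sequence is independent of the remaining i.i.d. sequence. -/
theorem measurePreserving_consSeq {A : Type*} [MeasurableSpace A] (ρ : Measure A)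
    [IsProbabilityMeasure ρ] :
    MeasurePreserving (fun p : A × (ℕ → A) => consSeq p.1 p.2)
      (ρ.prod (Measure.infinitePi fun _ : ℕ => ρ)) (Measure.infinitePi fun _ : ℕ => ρ) := by
  refine ⟨measurable_consSeq, Measure.eq_infinitePi _ fun s t ht => ?_⟩
  classical
  obtain ⟨n, hn⟩ : ∃ n, s ⊆ Finset.range (n + 1) := by
    obtain ⟨n, hn⟩ := s.exists_nat_subset_range
    exact ⟨n, hn.trans (Finset.range_mono n.le_succ)⟩
  -- Padding the cylinder with `Set.univ` makes its index set an initial segment, from which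
  -- coordinate 0 splits off.
  let t' (i : ℕ) : Set A := if i ∈ s then t i else Set.univ
  have ht' (i : ℕ) : MeasurableSet (t' i) := by
    simp only [t']
    split_ifs
    · exact ht i
    · exact .univ
  have h1 : (fun p : A × (ℕ → A) => consSeq p.1 p.2) ⁻¹' (Set.pi s t) =
      t' 0 ×ˢ Set.pi (Finset.range n) fun i => t' (i + 1) := by
    ext ⟨a, ω⟩
    simp only [Set.mem_preimage, Set.mem_pi, Finset.mem_coe, Set.mem_prod, t', Finset.mem_range]
    constructor
    · intro h
      refine ⟨?_, fun i _ => ?_⟩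
      · split_ifs with h0
        · exact h 0 h0
        · trivial
      · split_ifs with h0
        · exact h (i + 1) h0
        · trivial
    · rintro ⟨h0, h1⟩ i hi
      cases i with
      | zero => rwa [if_pos hi] at h0
      | succ i =>
        have h2 := h1 i (by simpa using hn hi)
        rwa [if_pos hi] at h2
  rw [Measure.map_apply measurable_consSeq (.pi s.countable_toSet fun i _ => ht i), h1,
    Measure.prod_prod, Measure.infinitePi_pi _ fun i _ => ht' (i + 1), mul_comm,
    ← Finset.prod_range_succ' (fun i => ρ (t' i)),
    ← Finset.prod_subset hn (f := fun i => ρ (t' i))]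
  · exact Finset.prod_congr rfl fun i hi => by simp only [t', if_pos hi]
  · intro i _ hi
    simp [t', hi]

/-- The time of the `n`-th jump, for the waiting times `(ω i).1`. -/
def jumpTime {M : Type*} : ℕ → (ℕ → ℝ × M) → ℝ
  | 0, _ => 0
  | n + 1, ω => (ω 0).1 + jumpTime n fun i => ω (i + 1)

/-- The state after `n` jumps, for the marks `(ω i).2`. -/
def jumpState {E M : Type*} (step : E → M → E) : ℕ → E → (ℕ → ℝ × M) → E
  | 0, x, _ => x
  | n + 1, x, ω => jumpState step n (step x (ω 0).2) fun i => ω (i + 1)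

open Classical in
/-- The process which starts at `x` and jumps according to the waiting times and marks `ω`; after
an explosion it stays at `c`. -/
noncomputable def jumpProcess {E M : Type*} (step : E → M → E) (c x : E) (t : ℝ)
    (ω : ℕ → ℝ × M) : E :=
  if h : ∃ n, t < jumpTime (n + 1) ω then jumpState step (Nat.find h) x ω else c

section jumpProcess

variable {E M : Type*} (step : E → M → E) (c : E)

theorem jumpProcess_eq_jumpState {x : E} {t : ℝ} {ω : ℕ → ℝ × M} {n : ℕ}
    (h1 : t < jumpTime (n + 1) ω) (h2 : ∀ m < n, jumpTime (m + 1) ω ≤ t) :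
    jumpProcess step c x t ω = jumpState step n x ω := by
  classical
  have h : ∃ n, t < jumpTime (n + 1) ω := ⟨n, h1⟩
  rw [jumpProcess, dif_pos h]
  congr 1
  exact (Nat.find_eq_iff h).2 ⟨h1, fun m hm => not_lt.2 (h2 m hm)⟩

theorem jumpProcess_eq_default {x : E} {t : ℝ} {ω : ℕ → ℝ × M}
    (h : ∀ n, jumpTime (n + 1) ω ≤ t) : jumpProcess step c x t ω = c := by
  rw [jumpProcess, dif_neg (by simpa using h)]

theorem exists_first_jumpTime_gt (t : ℝ) (ω : ℕ → ℝ × M) :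
    (∃ n, t < jumpTime (n + 1) ω ∧ ∀ m < n, jumpTime (m + 1) ω ≤ t) ∨
      ∀ n, jumpTime (n + 1) ω ≤ t := by
  classical
  by_cases h : ∃ n, t < jumpTime (n + 1) ω
  · exact .inl ⟨Nat.find h, Nat.find_spec h, fun m hm => not_lt.1 (Nat.find_min h hm)⟩
  · exact .inr (by simpa using h)

theorem jumpProcess_consSeq_of_lt {x : E} {t : ℝ} {a : ℝ × M} {ω : ℕ → ℝ × M} (h : t < a.1) :
    jumpProcess step c x t (consSeq a ω) = x :=
  jumpProcess_eq_jumpState step c (n := 0) (by simpa [jumpTime, consSeq] using h) (by simp)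

/-- Regeneration at the first jump. It holds for every sequence, even with negative waiting times or
after an explosion, so no almost sure argument is needed here. -/
theorem jumpProcess_consSeq_of_le {x : E} {t : ℝ} {a : ℝ × M} {ω : ℕ → ℝ × M} (h : a.1 ≤ t) :
    jumpProcess step c x t (consSeq a ω) =
      jumpProcess step c (step x a.2) (t - a.1) ω := by
  have hT (n : ℕ) : jumpTime (n + 1) (consSeq a ω) = a.1 + jumpTime n ω := rfl
  rcases exists_first_jumpTime_gt (t - a.1) ω with ⟨n, h1, h2⟩ | h1
  · rw [jumpProcess_eq_jumpState step c h1 h2,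
      jumpProcess_eq_jumpState step c (n := n + 1) (by rw [hT]; linarith)]
    · rfl
    · intro m hm
      rw [hT]
      cases m with
      | zero => simpa [jumpTime] using h
      | succ m =>
        have := h2 m (by omega)
        linarith
  · rw [jumpProcess_eq_default step c h1, jumpProcess_eq_default]
    intro n
    rw [hT]
    cases n with
    | zero => simpa [jumpTime] using h
    | succ n =>
      have := h1 n
      linarith

/-- Jump times that are at most `t` stay below later times, and the next one exceeds `t` strictly.
So the selected index, or the default, persists for a while. -/
theorem rightContinuousPath_jumpProcess (x : E) (ω : ℕ → ℝ × M) :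
    RightContinuousPath fun t : ℝ≥0 => jumpProcess step c x t ω := by
  intro t
  rcases exists_first_jumpTime_gt (t : ℝ) ω with ⟨n, h1, h2⟩ | h1
  · have h3 : ∀ᶠ s : ℝ≥0 in 𝓝[>] t, (s : ℝ) < jumpTime (n + 1) ω :=
      nhdsWithin_le_nhds ((NNReal.continuous_coe.tendsto t).eventually_lt_const h1)
    filter_upwards [h3, self_mem_nhdsWithin] with s hs hts
    rw [jumpProcess_eq_jumpState step c h1 h2, jumpProcess_eq_jumpState step c hs]
    exact fun m hm => (h2 m hm).trans (NNReal.coe_le_coe.2 (le_of_lt hts))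
  · filter_upwards [self_mem_nhdsWithin] with s hts
    rw [jumpProcess_eq_default step c h1, jumpProcess_eq_default step c]
    exact fun m => (h1 m).trans (NNReal.coe_le_coe.2 (le_of_lt hts))

/-- A relation which is preserved by the common marks holds for all times. -/
theorem jumpProcess_rel {F : Type*} {step' : F → M → F} {R : E → F → Prop} {c' : F}
    (hc : R c c') {ω : ℕ → ℝ × M}
    (hR : ∀ i x y, R x y → R (step x (ω i).2) (step' y (ω i).2)) {x : E} {y : F} (h : R x y)
    (t : ℝ) : R (jumpProcess step c x t ω) (jumpProcess step' c' y t ω) := by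
  have key : ∀ (n : ℕ) (ω : ℕ → ℝ × M) (x : E) (y : F), R x y →
      (∀ i x y, R x y → R (step x (ω i).2) (step' y (ω i).2)) →
      R (jumpState step n x ω) (jumpState step' n y ω) := by
    intro n
    induction n with
    | zero => exact fun _ _ _ h _ => h
    | succ n ih => exact fun ω x y h hω => ih _ _ _ (hω 0 x y h) fun i => hω (i + 1)
  -- The number of jumps depends only on the waiting times, so it agrees in both systems.
  rcases exists_first_jumpTime_gt t ω with ⟨n, h1, h2⟩ | h1
  · rw [jumpProcess_eq_jumpState step c h1 h2, jumpProcess_eq_jumpState step' c' h1 h2]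
    exact key n ω x y h hR
  · rwa [jumpProcess_eq_default step c h1, jumpProcess_eq_default step' c' h1]

variable [MeasurableSpace M]

theorem measurable_jumpTime (n : ℕ) : Measurable (jumpTime (M := M) n) := by
  induction n with
  | zero => exact measurable_const
  | succ n ih =>
    exact (measurable_fst.comp (measurable_pi_apply 0)).add
      (ih.comp (measurable_pi_lambda _ fun i => measurable_pi_apply (i + 1)))

variable [MeasurableSpace E] [DiscreteMeasurableSpace E] [Countable E]

theorem measurable_jumpState (hstep : ∀ x, Measurable (step x)) (n : ℕ) (x : E) :
    Measurable (jumpState step n x) := by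
  induction n generalizing x with
  | zero => exact measurable_const
  | succ n ih =>
    have h1 : Measurable fun p : E × (ℕ → ℝ × M) => jumpState step n p.1 p.2 :=
      measurable_from_prod_countable_right fun x => ih x
    exact h1.comp (((hstep x).comp (measurable_snd.comp (measurable_pi_apply 0))).prodMk
      (measurable_pi_lambda _ fun i => measurable_pi_apply (i + 1)))

theorem measurable_jumpProcess (hstep : ∀ x, Measurable (step x)) (x : E) :
    Measurable fun p : ℝ × (ℕ → ℝ × M) => jumpProcess step c x p.1 p.2 := by
  have hT (n : ℕ) : Measurable fun p : ℝ × (ℕ → ℝ × M) => jumpTime n p.2 :=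
    (measurable_jumpTime n).comp measurable_snd
  refine measurable_to_countable' fun e => ?_
  have h1 : (fun p : ℝ × (ℕ → ℝ × M) => jumpProcess step c x p.1 p.2) ⁻¹' {e} =
      (⋃ n, ({p | p.1 < jumpTime (n + 1) p.2} ∩ ⋂ m, ⋂ (_ : m < n),
          {p : ℝ × (ℕ → ℝ × M) | jumpTime (m + 1) p.2 ≤ p.1}) ∩
            {p | jumpState step n x p.2 ∈ ({e} : Set E)}) ∪
        ((⋂ n, {p : ℝ × (ℕ → ℝ × M) | jumpTime (n + 1) p.2 ≤ p.1}) ∩ {_p | c = e}) := by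
    ext ⟨t, ω⟩
    simp only [Set.mem_preimage, Set.mem_singleton_iff, Set.mem_union, Set.mem_iUnion,
      Set.mem_inter_iff, Set.mem_ofPred_eq, Set.mem_iInter]
    constructor
    · intro h
      rcases exists_first_jumpTime_gt t ω with ⟨n, h1, h2⟩ | h1
      · rw [jumpProcess_eq_jumpState step c h1 h2] at h
        exact .inl ⟨n, ⟨h1, h2⟩, h⟩
      · rw [jumpProcess_eq_default step c h1] at h
        exact .inr ⟨h1, h⟩
    · rintro (⟨n, ⟨h1, h2⟩, h⟩ | ⟨h1, h⟩)
      · rw [jumpProcess_eq_jumpState step c h1 h2, h]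
      · rw [jumpProcess_eq_default step c h1, h]
  rw [h1]
  refine .union (.iUnion fun n => .inter (.inter ?_ (.iInter fun m => .iInter fun _ => ?_)) ?_)
    (.inter (.iInter fun n => ?_) (.const _))
  · exact measurableSet_lt measurable_fst (hT _)
  · exact measurableSet_le (hT _) measurable_fst
  · exact ((measurable_jumpState step hstep n x).comp measurable_snd) .of_discrete
  · exact measurableSet_le (hT _) measurable_fst

end jumpProcess

/-! ## Renewal equations -/

theorem integral_expMeasure {Λ : ℝ} (hΛ : 0 < Λ) (g : ℝ → ℝ) :
    ∫ s, g s ∂(expMeasure Λ) = ∫ s in Set.Ioi 0, Λ * Real.exp (-(Λ * s)) * g s := by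
  have hm : Measurable (exponentialPDF Λ) := (measurable_exponentialPDFReal Λ).ennreal_ofReal
  change ∫ s, g s ∂(volume.withDensity (exponentialPDF Λ)) = _
  rw [integral_withDensity_eq_integral_toReal_smul hm
    (ae_of_all _ fun _ => ENNReal.ofReal_lt_top), ← integral_Ici_eq_integral_Ioi,
    ← integral_indicator measurableSet_Ici]
  refine integral_congr_ae (ae_of_all _ fun s => ?_)
  by_cases hs : 0 ≤ s
  · rw [Set.indicator_of_mem (by exact hs)]
    simp only [exponentialPDF_of_nonneg hs, smul_eq_mul]
    rw [ENNReal.toReal_ofReal (by positivity)]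
  · rw [Set.indicator_of_notMem (by exact hs)]
    simp [exponentialPDF_of_neg (not_le.1 hs)]

theorem integrableOn_exp_mul {Λ : ℝ} (hΛ : 0 < Λ) {g : ℝ → ℝ} (hg : Measurable g) {C : ℝ}
    (hC : ∀ s, |g s| ≤ C) :
    IntegrableOn (fun s => Λ * Real.exp (-(Λ * s)) * g s) (Set.Ioi 0) := by
  have h1 : IntegrableOn (fun s => Λ * Real.exp (-(Λ * s))) (Set.Ioi 0) := by
    have h2 := (exp_neg_integrableOn_Ioi 0 hΛ).const_mul Λ
    simp only [neg_mul] at h2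
    exact h2
  exact h1.mul_bdd (c := C) hg.aestronglyMeasurable (ae_of_all _ hC)

/-- The lack of memory of the exponential distribution. -/
theorem integral_expMeasure_eq_add {Λ : ℝ} (hΛ : 0 < Λ) {g h : ℝ → ℝ} (hg : Measurable g) {C : ℝ}
    (hC : ∀ s, |g s| ≤ C) {t : ℝ} (ht : 0 ≤ t) (hgh : ∀ s, t < s → g s = h (s - t)) :
    ∫ s, g s ∂(expMeasure Λ) = Real.exp (-(Λ * t)) * ∫ s, h s ∂(expMeasure Λ) +
      ∫ s in (0 : ℝ)..t, Λ * Real.exp (-(Λ * s)) * g s := by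
  have hi := integrableOn_exp_mul hΛ hg hC
  rw [integral_expMeasure hΛ, integral_expMeasure hΛ, ← Set.Ioc_union_Ioi_eq_Ioi ht,
    setIntegral_union (Set.Ioc_disjoint_Ioi le_rfl) measurableSet_Ioi
      (hi.mono_set Set.Ioc_subset_Ioi_self) (hi.mono_set (Set.Ioi_subset_Ioi ht)),
    intervalIntegral.integral_of_le ht, add_comm, Set.Ioc_union_Ioi_eq_Ioi ht]
  congr 1
  rw [← integral_const_mul, ← integral_indicator measurableSet_Ioi,
    ← integral_indicator measurableSet_Ioi,
    ← integral_sub_right_eq_self (Set.indicator (Set.Ioi (0 : ℝ)) _) t]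
  refine integral_congr_ae (ae_of_all _ fun s => ?_)
  by_cases hs : t < s
  · simp only
    rw [Set.indicator_of_mem (by exact hs), Set.indicator_of_mem (by exact sub_pos.2 hs), hgh s hs,
      ← mul_assoc, mul_left_comm, ← Real.exp_add]
    ring_nf
  · simp only
    rw [Set.indicator_of_notMem (by exact hs), Set.indicator_of_notMem (by simpa using hs)]

theorem integral_mul_exp_neg (Λ t : ℝ) :
    ∫ s in (0 : ℝ)..t, Λ * Real.exp (-(Λ * s)) = 1 - Real.exp (-(Λ * t)) := by
  rw [intervalIntegral.integral_eq_sub_of_hasDerivAt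
    (fun s _ => hasDerivAt_neg_exp_mul_exp) (Continuous.intervalIntegrable (by fun_prop) _ _)]
  simp
  ring

section renewal

variable {E M : Type*} [MeasurableSpace M] {ν : Measure M} [IsProbabilityMeasure ν]
  {step : E → M → E}

theorem measurable_comp_step [MeasurableSpace E] [DiscreteMeasurableSpace E] [Countable E]
    (hstep : ∀ x, Measurable (step x)) {u : E → ℝ → ℝ} (hu : ∀ x, Measurable (u x)) (x : E)
    (t : ℝ) : Measurable fun p : ℝ × M => u (step x p.2) (t - p.1) := by
  have h1 : Measurable fun p : E × ℝ => u p.1 p.2 := measurable_from_prod_countable_right hu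
  exact h1.comp (((hstep x).comp measurable_snd).prodMk (measurable_fst.const_sub t))

/-- Uniqueness of locally bounded solutions of the renewal equation. -/
theorem eq_of_renewal [MeasurableSpace E] [DiscreteMeasurableSpace E] [Countable E] {Λ : ℝ}
    (hΛ : 0 < Λ) (hstep : ∀ x, Measurable (step x)) {u v g : E → ℝ → ℝ}
    (hum : ∀ x, Measurable (u x)) (hvm : ∀ x, Measurable (v x)) {C T : ℝ}
    (huC : ∀ x, ∀ t ∈ Set.Icc 0 T, |u x t| ≤ C) (hvC : ∀ x, ∀ t ∈ Set.Icc 0 T, |v x t| ≤ C)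
    (hu : ∀ x, ∀ t ∈ Set.Icc 0 T, u x t = g x t +
      ∫ s in (0 : ℝ)..t, Λ * Real.exp (-(Λ * s)) * ∫ m, u (step x m) (t - s) ∂ν)
    (hv : ∀ x, ∀ t ∈ Set.Icc 0 T, v x t = g x t +
      ∫ s in (0 : ℝ)..t, Λ * Real.exp (-(Λ * s)) * ∫ m, v (step x m) (t - s) ∂ν)
    (x : E) {t : ℝ} (ht : t ∈ Set.Icc 0 T) : u x t = v x t := by
  have hT : 0 ≤ T := ht.1.trans ht.2
  have hC0 : 0 ≤ C := (abs_nonneg _).trans (huC x t ht)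
  -- The probability of a jump before `T`: the renewal operator contracts by this factor.
  let q := 1 - Real.exp (-(Λ * T))
  have hq0 : 0 ≤ q := by
    have : Real.exp (-(Λ * T)) ≤ 1 := Real.exp_le_one_iff.2 (by nlinarith)
    simp only [q]
    linarith
  have hq1 : q < 1 := by
    have := Real.exp_pos (-(Λ * T))
    simp only [q]
    linarith
  have hint {w : E → ℝ → ℝ} (hw : ∀ x, Measurable (w x))
      (hwC : ∀ x, ∀ t ∈ Set.Icc 0 T, |w x t| ≤ C) (x : E) {t : ℝ} (ht : t ∈ Set.Icc 0 T) :
      IntervalIntegrable (fun s => Λ * Real.exp (-(Λ * s)) * ∫ m, w (step x m) (t - s) ∂ν)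
        volume 0 t := by
    have h1 : StronglyMeasurable fun s => ∫ m, w (step x m) (t - s) ∂ν :=
      (measurable_comp_step hstep hw x t).stronglyMeasurable.integral_prod_right'
        (f := fun p : ℝ × M => w (step x p.2) (t - p.1))
    have h2 : IntervalIntegrable (fun s => ∫ m, w (step x m) (t - s) ∂ν) volume 0 t := by
      rw [intervalIntegrable_iff, Set.uIoc_of_le ht.1]
      refine Measure.integrableOn_of_bounded (M := C) (by simp) h1.aestronglyMeasurable ?_
      rw [ae_restrict_iff' measurableSet_Ioc]
      refine ae_of_all _ fun s hs => ?_
      refine (norm_integral_le_of_norm_le_const (C := C) (ae_of_all _ fun m =>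
        hwC _ _ ⟨by linarith [hs.2], by linarith [hs.1, ht.2]⟩)).trans ?_
      simp
    exact h2.continuousOn_mul (Continuous.continuousOn (by fun_prop))
  have hinner {w : E → ℝ → ℝ} (hw : ∀ x, Measurable (w x))
      (hwC : ∀ x, ∀ t ∈ Set.Icc 0 T, |w x t| ≤ C) (x : E) {t s : ℝ} (hts : t - s ∈ Set.Icc 0 T) :
      Integrable (fun m => w (step x m) (t - s)) ν :=
    Integrable.of_bound (C := C) ((measurable_comp_step hstep hw x t).comp
      (measurable_prodMk_left (x := s))).aestronglyMeasurable
      (ae_of_all _ fun m => hwC _ _ hts)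
  have key : ∀ n : ℕ, ∀ x, ∀ t ∈ Set.Icc 0 T, |u x t - v x t| ≤ 2 * C * q ^ n := by
    intro n
    induction n with
    | zero =>
      intro x t ht
      have := abs_sub (u x t) (v x t)
      linarith [huC x t ht, hvC x t ht]
    | succ n ih =>
      intro x t ht
      rw [hu x t ht, hv x t ht, add_sub_add_left_eq_sub,
        ← intervalIntegral.integral_sub (hint hum huC x ht) (hint hvm hvC x ht)]
      have h1 : ‖∫ s in (0 : ℝ)..t, (Λ * Real.exp (-(Λ * s)) * ∫ m, u (step x m) (t - s) ∂ν -
          Λ * Real.exp (-(Λ * s)) * ∫ m, v (step x m) (t - s) ∂ν)‖ ≤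
          ∫ s in (0 : ℝ)..t, Λ * Real.exp (-(Λ * s)) * (2 * C * q ^ n) := by
        refine intervalIntegral.norm_integral_le_of_norm_le ht.1 (ae_of_all _ fun s hs => ?_)
          (Continuous.intervalIntegrable (by fun_prop) _ _)
        have hts : t - s ∈ Set.Icc 0 T := ⟨by linarith [hs.2], by linarith [hs.1, ht.2]⟩
        rw [← mul_sub, ← integral_sub (hinner hum huC x hts) (hinner hvm hvC x hts), norm_mul,
          Real.norm_of_nonneg (by positivity)]
        gcongr
        refine (norm_integral_le_of_norm_le_const (ae_of_all _ fun m => ih _ _ hts)).trans ?_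
        simp
      refine h1.trans ?_
      rw [intervalIntegral.integral_mul_const, integral_mul_exp_neg, pow_succ, mul_comm,
        ← mul_assoc]
      have h2 : 1 - Real.exp (-(Λ * t)) ≤ q := by
        simp only [q]
        gcongr
        exact ht.2
      gcongr
  have hlim : Tendsto (fun n : ℕ => 2 * C * q ^ n) atTop (𝓝 0) := by
    simpa using (tendsto_pow_atTop_nhds_zero_of_lt_one hq0 hq1).const_mul (2 * C)
  exact sub_eq_zero.1 (abs_nonpos_iff.1 (ge_of_tendsto' hlim fun n => key n x t ht))

/-- The renewal equation for the semigroup generated by `Λ (K - 1)`. -/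
theorem apply_evolution_renewal {V : Type*} [NormedAddCommGroup V] [NormedSpace ℝ V]
    [CompleteSpace V] (K : V →L[ℝ] V) (Λ : ℝ) (φ : V →L[ℝ] ℝ) (f : V) (t : ℝ) :
    φ (evolution (Λ • (K - 1)) t f) = Real.exp (-(Λ * t)) * φ f +
      ∫ s in (0 : ℝ)..t, Λ * Real.exp (-(Λ * s)) * φ (K (evolution (Λ • (K - 1)) (t - s) f)) := by
  -- Variation of constants: the derivative of the exponential cancels the `-1` in the generator,
  -- leaving only `K`.
  have hd (s : ℝ) : HasDerivAt
      (fun s => -Real.exp (-(Λ * s)) * φ (evolution (Λ • (K - 1)) (t - s) f))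
      (Λ * Real.exp (-(Λ * s)) * φ (K (evolution (Λ • (K - 1)) (t - s) f))) s := by
    have h1 := (hasDerivAt_apply_evolution' (Λ • (K - 1)) φ f (t - s)).comp_const_sub t s
    refine ((hasDerivAt_neg_exp_mul_exp (r := Λ) (x := s)).mul h1).congr_deriv ?_
    simp
    ring
  have hc : Continuous fun s => φ (K (evolution (Λ • (K - 1)) (t - s) f)) :=
    (continuous_apply_evolution (Λ • (K - 1)) (φ.comp K) f).comp (continuous_const.sub continuous_id)
  rw [intervalIntegral.integral_eq_sub_of_hasDerivAt (fun s _ => hd s)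
    (Continuous.intervalIntegrable (Continuous.mul (by fun_prop) hc) _ _)]
  simp [evolution_zero]

open BoundedContinuousFunction

/-- The transition operator of one random step. -/
noncomputable def stepOperator [TopologicalSpace E] [DiscreteTopology E] (ν : Measure M)
    [IsProbabilityMeasure ν] [MeasurableSpace E] [DiscreteMeasurableSpace E] (step : E → M → E)
    (hstep : ∀ x, Measurable (step x)) : (E →ᵇ ℝ) →L[ℝ] (E →ᵇ ℝ) :=
  have hi (f : E →ᵇ ℝ) (x : E) : Integrable (fun m => f (step x m)) ν := by
    simpa using integrable_boundedFunction (P := ν) (hstep x) f Set.univ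
  have hb (f : E →ᵇ ℝ) (x : E) : ‖∫ m, f (step x m) ∂ν‖ ≤ ‖f‖ := by
    simpa using abs_setIntegral_le (P := ν) (Z := step x) f Set.univ
  LinearMap.mkContinuous
    { toFun := fun f => ofNormedAddCommGroupDiscrete (fun x => ∫ m, f (step x m) ∂ν) ‖f‖ (hb f)
      map_add' := fun f g => by
        ext x
        exact integral_add (hi f x) (hi g x)
      map_smul' := fun c f => by
        ext x
        exact integral_const_mul c _ } 1
    fun f => by
      rw [one_mul]
      exact (norm_le (norm_nonneg f)).2 (hb f)

theorem stepOperator_apply [TopologicalSpace E] [DiscreteTopology E]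
    [MeasurableSpace E] [DiscreteMeasurableSpace E]
    (hstep : ∀ x, Measurable (step x)) (f : E →ᵇ ℝ) (x : E) :
    stepOperator ν step hstep f x = ∫ m, f (step x m) ∂ν := rfl

end renewal

/-! ## The Markov property of the process driven by exponential times and independent marks -/

open BoundedContinuousFunction

/-- The law of i.i.d. waiting times and marks. -/
noncomputable def drivingLaw {M : Type*} [MeasurableSpace M] (Λ : ℝ) (ν : Measure M) :
    Measure (ℕ → ℝ × M) :=
  Measure.infinitePi fun _ : ℕ => (expMeasure Λ).prod ν

section driving

variable {M : Type*} [MeasurableSpace M] {ν : Measure M} [IsProbabilityMeasure ν] {Λ : ℝ}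

theorem isProbabilityMeasure_drivingLaw (hΛ : 0 < Λ) : IsProbabilityMeasure (drivingLaw Λ ν) := by
  have := isProbabilityMeasure_expMeasure hΛ
  rw [drivingLaw]
  infer_instance

/-- The probability of an event, given the first waiting time. -/
noncomputable def firstTimeProb (Λ : ℝ) (ν : Measure M) (S : Set (ℕ → ℝ × M)) (s : ℝ) : ℝ :=
  ∫ m, (drivingLaw Λ ν).real {ω | consSeq (s, m) ω ∈ S} ∂ν

theorem measurable_real_consSeq_mem (hΛ : 0 < Λ) {S : Set (ℕ → ℝ × M)} (hS : MeasurableSet S) :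
    Measurable fun a : ℝ × M => (drivingLaw Λ ν).real {ω | consSeq a ω ∈ S} := by
  have := isProbabilityMeasure_drivingLaw (ν := ν) hΛ
  exact (measurable_measure_prodMk_left (measurable_consSeq hS)).ennreal_toReal

theorem measurable_firstTimeProb (hΛ : 0 < Λ) {S : Set (ℕ → ℝ × M)} (hS : MeasurableSet S) :
    Measurable (firstTimeProb Λ ν S) :=
  ((measurable_real_consSeq_mem hΛ hS).stronglyMeasurable.integral_prod_right'
    (f := fun a : ℝ × M => (drivingLaw Λ ν).real {ω | consSeq a ω ∈ S})).measurable

theorem abs_firstTimeProb_le (hΛ : 0 < Λ) (S : Set (ℕ → ℝ × M)) (s : ℝ) :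
    |firstTimeProb Λ ν S s| ≤ 1 := by
  have := isProbabilityMeasure_drivingLaw (ν := ν) hΛ
  have h : ‖firstTimeProb Λ ν S s‖ ≤ 1 * ν.real Set.univ :=
    norm_integral_le_of_norm_le_const (ae_of_all _ fun m => by
      rw [Real.norm_of_nonneg measureReal_nonneg]
      exact measureReal_le_one)
  simpa using h

theorem integral_firstTimeProb (hΛ : 0 < Λ) {S : Set (ℕ → ℝ × M)} (hS : MeasurableSet S) :
    ∫ s, firstTimeProb Λ ν S s ∂(expMeasure Λ) = (drivingLaw Λ ν).real S := by
  have h1 := isProbabilityMeasure_drivingLaw (ν := ν) hΛ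
  have h2 := isProbabilityMeasure_expMeasure hΛ
  have h3 : Integrable (fun a : ℝ × M => (drivingLaw Λ ν).real {ω | consSeq a ω ∈ S})
      ((expMeasure Λ).prod ν) :=
    Integrable.of_bound (C := 1) (measurable_real_consSeq_mem hΛ hS).aestronglyMeasurable
      (ae_of_all _ fun a => by
        rw [Real.norm_of_nonneg measureReal_nonneg]
        exact measureReal_le_one)
  have h4 := integral_prod _ h3
  have hmp := measurePreserving_consSeq ((expMeasure Λ).prod ν)
  have h5 : (drivingLaw Λ ν) S =
      ∫⁻ a, (drivingLaw Λ ν) {ω | consSeq a ω ∈ S} ∂((expMeasure Λ).prod ν) := by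
    conv_lhs => rw [drivingLaw, ← hmp.measure_preimage hS.nullMeasurableSet]
    exact Measure.prod_apply (measurable_consSeq hS)
  simp only [firstTimeProb]
  rw [← h4, measureReal_def, h5, integral_eq_lintegral_of_nonneg_ae (ae_of_all _ fun _ => measureReal_nonneg)
    h3.aestronglyMeasurable]
  congr 1
  refine lintegral_congr fun a => ?_
  rw [ofReal_measureReal]

end driving

section markov

variable {E M : Type*} [MeasurableSpace M] {ν : Measure M} [IsProbabilityMeasure ν]
  [MeasurableSpace E] [DiscreteMeasurableSpace E] [Countable E] {step : E → M → E} {c : E} {Λ : ℝ}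

/-- The trajectory of the jump process follows `e` at the listed times, after a time shift. -/
def followEvent (step : E → M → E) (c : E) (e : ℝ≥0 → E) (ts : List ℝ≥0) (x : E) (t : ℝ) :
    Set (ℕ → ℝ × M) :=
  {ω | ∀ u ∈ ts, jumpProcess step c x (t + u) ω = e u}

theorem measurableSet_followEvent_prod (hstep : ∀ x, Measurable (step x)) (e : ℝ≥0 → E)
    (ts : List ℝ≥0) (x : E) :
    MeasurableSet {p : ℝ × (ℕ → ℝ × M) | p.2 ∈ followEvent step c e ts x p.1} := by
  have h1 : {p : ℝ × (ℕ → ℝ × M) | p.2 ∈ followEvent step c e ts x p.1} =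
      ⋂ u ∈ {u | u ∈ ts}, {p : ℝ × (ℕ → ℝ × M) | jumpProcess step c x (p.1 + (u : ℝ)) p.2 = e u} := by
    ext p
    simp [followEvent]
  rw [h1]
  refine MeasurableSet.biInter ts.finite_toSet.countable fun u _ => ?_
  exact ((measurable_jumpProcess step c hstep x).comp
    ((measurable_fst.add_const (u : ℝ)).prodMk measurable_snd)) (.of_discrete (s := {e u}))

theorem measurableSet_followEvent (hstep : ∀ x, Measurable (step x)) (e : ℝ≥0 → E)
    (ts : List ℝ≥0) (x : E) (t : ℝ) : MeasurableSet (followEvent step c e ts x t) :=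
  measurable_prodMk_left (measurableSet_followEvent_prod hstep e ts x)

theorem measurableSet_jumpProcess_eq (hstep : ∀ x, Measurable (step x)) (x y : E) (t : ℝ) :
    MeasurableSet {ω | jumpProcess step c x t ω = y} :=
  ((measurable_jumpProcess step c hstep x).comp measurable_prodMk_left)
    (.of_discrete (s := {y}))

/-- Condition on the first waiting time `s`. If `s > t`, the state at `t` is still `x`, and lack of
memory restarts the future with waiting time `s - t`. If `s ≤ t`, the process restarts from `step x
m` with `t - s` left. The listed times are absolute with origin `o`; `o ≤ u` places the observations
at or after `t`. -/
theorem real_markov_renewal (hΛ : 0 < Λ) (hstep : ∀ x, Measurable (step x)) (e : ℝ≥0 → E)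
    {ts : List ℝ≥0} {o : ℝ≥0} (ho : ∀ u ∈ ts, o ≤ u) (y x : E) {t : ℝ} (ht : 0 ≤ t) :
    (drivingLaw Λ ν).real
        ({ω | jumpProcess step c x t ω = y} ∩ followEvent step c e ts x (t - o)) =
      Real.exp (-(Λ * t)) * (Set.indicator {y} 1 x *
        (drivingLaw Λ ν).real (followEvent step c e ts y (-o))) +
      ∫ s in (0 : ℝ)..t, Λ * Real.exp (-(Λ * s)) * ∫ m, (drivingLaw Λ ν).real
        ({ω | jumpProcess step c (step x m) (t - s) ω = y} ∩
          followEvent step c e ts (step x m) (t - s - o)) ∂ν := by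
  have hS (x : E) (t : ℝ) : MeasurableSet
      ({ω | jumpProcess step c x t ω = y} ∩ followEvent step c e ts x (t - o)) :=
    (measurableSet_jumpProcess_eq hstep x y t).inter (measurableSet_followEvent hstep e ts x _)
  rw [← integral_firstTimeProb hΛ (hS x t), integral_expMeasure_eq_add hΛ
    (measurable_firstTimeProb hΛ (hS x t)) (abs_firstTimeProb_le hΛ _) ht
    (h := fun s => Set.indicator {y} 1 x *
      firstTimeProb Λ ν (followEvent step c e ts y (-o)) s),
    integral_const_mul, integral_firstTimeProb hΛ (measurableSet_followEvent hstep e ts y _)]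
  · congr 1
    refine intervalIntegral.integral_congr_ae (ae_of_all _ fun s hs => ?_)
    rw [Set.uIoc_of_le ht] at hs
    rw [firstTimeProb]
    congr 1
    refine integral_congr_ae (ae_of_all _ fun m => ?_)
    simp only
    congr 1
    ext ω
    simp only [Set.mem_inter_iff, Set.mem_ofPred_eq, followEvent]
    rw [jumpProcess_consSeq_of_le step c hs.2]
    refine and_congr_right fun _ => forall₂_congr fun u hu => ?_
    have hu' : (o : ℝ) ≤ u := NNReal.coe_le_coe.2 (ho u hu)
    rw [jumpProcess_consSeq_of_le step c (by simp only; linarith [hs.2])]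
    ring_nf
  · intro s hts
    simp only [firstTimeProb]
    by_cases hxy : x = y
    · subst hxy
      rw [Set.indicator_of_mem (Set.mem_singleton x), Pi.one_apply, one_mul]
      refine integral_congr_ae (ae_of_all _ fun m => ?_)
      simp only
      congr 1
      ext ω
      simp only [Set.mem_inter_iff, Set.mem_ofPred_eq, followEvent]
      rw [jumpProcess_consSeq_of_lt step c hts]
      simp only [true_and]
      refine forall₂_congr fun u hu => ?_
      -- The observation may fall before or after the first jump; in both cases the waiting time and
      -- the observation time are reduced by the same `t`.
      by_cases h : t - o + u < s
      · rw [jumpProcess_consSeq_of_lt step c h,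
          jumpProcess_consSeq_of_lt step c (by simp only; linarith)]
      · rw [jumpProcess_consSeq_of_le step c (not_lt.1 h),
          jumpProcess_consSeq_of_le step c (by simp only; linarith)]
        ring_nf
    · rw [Set.indicator_of_notMem (by simpa using hxy), zero_mul]
      refine (integral_congr_ae (ae_of_all _ fun m => ?_)).trans (integral_zero _ _)
      convert measureReal_empty
      ext ω
      simp only [Set.mem_inter_iff, Set.mem_ofPred_eq, Set.mem_empty_iff_false, iff_false, not_and]
      rw [jumpProcess_consSeq_of_lt step c hts]
      exact fun h => absurd h hxy

variable [TopologicalSpace E] [DiscreteTopology E]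

/-- The generator `Λ (K - 1)` of the jump process, for the transition operator `K` of one step. -/
noncomputable def stepGenerator (Λ : ℝ) (ν : Measure M) [IsProbabilityMeasure ν] (step : E → M → E)
    (hstep : ∀ x, Measurable (step x)) : (E →ᵇ ℝ) →L[ℝ] (E →ᵇ ℝ) :=
  Λ • (stepOperator ν step hstep - 1)

/-- The Markov property at a deterministic time. -/
theorem real_markov (hΛ : 0 < Λ) (hstep : ∀ x, Measurable (step x)) (e : ℝ≥0 → E)
    {ts : List ℝ≥0} {o : ℝ≥0} (ho : ∀ u ∈ ts, o ≤ u) (x y : E) (t : ℝ≥0) :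
    (drivingLaw Λ ν).real
        ({ω | jumpProcess step c x t ω = y} ∩ followEvent step c e ts x (t - o)) =
      transition (stepGenerator Λ ν step hstep) t x y *
        (drivingLaw Λ ν).real (followEvent step c e ts y (-o)) := by
  have hP := isProbabilityMeasure_drivingLaw (ν := ν) hΛ
  let B := stepGenerator Λ ν step hstep
  let p := (drivingLaw Λ ν).real (followEvent step c e ts y (-o))
  have hp0 : 0 ≤ p := measureReal_nonneg
  have hp1 : p ≤ 1 := measureReal_le_one
  let φ (x : E) : (E →ᵇ ℝ) →L[ℝ] ℝ := evalCLM ℝ x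
  have hφ (x : E) (f : E →ᵇ ℝ) : φ x f = f x := rfl
  obtain ⟨C, hC⟩ := exists_norm_evolution_le B (t : ℝ)
  have hI : ‖pointIndicator y‖ ≤ 1 := by
    refine (norm_le zero_le_one).2 fun x => ?_
    rw [pointIndicator_apply]
    by_cases h : x = y <;> simp [h]
  have hC0 : 0 ≤ C := (norm_nonneg _).trans (hC 0 ⟨le_rfl, t.2⟩)
  -- As functions of the starting state and the time, both sides solve the renewal equation with
  -- source `exp (-Λ t) * 1_{x = y} * p`.
  refine eq_of_renewal (ν := ν) hΛ hstep (C := 1 + C) (T := (t : ℝ))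
    (u := fun x t => (drivingLaw Λ ν).real
        ({ω | jumpProcess step c x t ω = y} ∩ followEvent step c e ts x (t - o)))
    (v := fun x t => φ x (evolution B t (pointIndicator y)) * p)
    (g := fun x t => Real.exp (-(Λ * t)) * (Set.indicator {y} 1 x * p))
    (fun x => ?_) (fun x => ?_) (fun x s hs => ?_) (fun x s hs => ?_) (fun x s hs => ?_)
    (fun x s hs => ?_) x ⟨t.2, le_rfl⟩
  · refine Measurable.ennreal_toReal ?_
    refine measurable_measure_prodMk_left (s := {q : ℝ × (ℕ → ℝ × M) |
      jumpProcess step c x q.1 q.2 = y} ∩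
        {q | q.2 ∈ followEvent step c e ts x (q.1 - o)}) (.inter ?_ ?_)
    · exact measurable_jumpProcess step c hstep x (.of_discrete (s := {y}))
    · exact ((measurable_fst.sub_const (o : ℝ)).prodMk measurable_snd)
        (measurableSet_followEvent_prod (c := c) hstep e ts x)
  · exact (continuous_apply_evolution B (φ x) _).measurable.mul_const p
  · rw [abs_of_nonneg measureReal_nonneg]
    exact measureReal_le_one.trans (by linarith)
  · rw [abs_mul, abs_of_nonneg hp0]
    refine (mul_le_of_le_one_right (abs_nonneg _) hp1).trans ?_
    rw [hφ]
    refine (norm_coe_le_norm (evolution B s (pointIndicator y)) x).trans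
      ((ContinuousLinearMap.le_opNorm _ _).trans ?_)
    have := mul_le_mul (hC s hs) hI (norm_nonneg _) hC0
    linarith
  · exact real_markov_renewal hΛ hstep e ho y x hs.1
  · have h1 := apply_evolution_renewal (stepOperator ν step hstep) Λ (φ x) (pointIndicator y) s
    conv_lhs => rw [show B = Λ • (stepOperator ν step hstep - 1) from rfl, h1]
    rw [add_mul, hφ, pointIndicator_apply, ← mul_assoc, ← intervalIntegral.integral_mul_const]
    congr 1
    refine intervalIntegral.integral_congr fun r _ => ?_
    rw [hφ, stepOperator_apply, mul_assoc, ← integral_mul_const]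
    rfl

/-- The finite-dimensional distributions of the jump process. -/
theorem real_followEvent (hΛ : 0 < Λ) (hstep : ∀ x, Measurable (step x)) (e : ℝ≥0 → E)
    (ts : List ℝ≥0) : ∀ {s : ℝ≥0}, (s :: ts).Pairwise (· ≤ ·) →
      (drivingLaw Λ ν).real (followEvent step c e ts (e s) (-s)) =
        pathWeight (stepGenerator Λ ν step hstep) e s ts := by
  have hP := isProbabilityMeasure_drivingLaw (ν := ν) hΛ
  induction ts with
  | nil => intro s _; simp [followEvent, pathWeight]
  | cons t ts ih =>
    intro s hp
    rw [List.pairwise_cons] at hp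
    have hst : s ≤ t := hp.1 t (by simp)
    -- The Markov property at time `t - s` with origin `o = t`: the later times then appear shifted
    -- by `t - s - t = -s`, as required.
    rw [pathWeight, ← ih hp.2, ← real_markov hΛ hstep e (List.pairwise_cons.1 hp.2).1]
    congr 1
    ext ω
    simp only [followEvent, Set.mem_inter_iff, Set.mem_ofPred_eq, List.forall_mem_cons,
      NNReal.coe_sub hst]
    ring_nf

end markov

/-! ## Equality of laws -/

open BoundedContinuousFunction

/-- The law of a process in a countable space is determined by the joint laws of its values at
finitely many times including `0`. -/
theorem measure_path_ext {E : Type*} [MeasurableSpace E] [DiscreteMeasurableSpace E] [Countable E]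
    {μ₁ μ₂ : Measure (ℝ≥0 → E)} [IsProbabilityMeasure μ₁] [IsProbabilityMeasure μ₂]
    (h : ∀ (e : ℝ≥0 → E) (ts : List ℝ≥0), (0 :: ts).Pairwise (· ≤ ·) →
      μ₁ {p | p 0 = e 0 ∧ ∀ t ∈ ts, p t = e t} = μ₂ {p | p 0 = e 0 ∧ ∀ t ∈ ts, p t = e t}) :
    μ₁ = μ₂ := by
  have hfin (J : Finset ℝ≥0) : IsFiniteMeasure (μ₂.map J.restrict) := inferInstance
  have h0 (J : Finset ℝ≥0) (hJ : 0 ∈ J) : μ₁.map J.restrict = μ₂.map J.restrict := by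
    classical
    refine Measure.ext_of_singleton fun g => ?_
    have hm : MeasurableSet ({g} : Set ((j : J) → E)) := measurableSet_singleton g
    rw [Measure.map_apply (Finset.measurable_restrict (X := fun _ => E) J) hm,
      Measure.map_apply (Finset.measurable_restrict (X := fun _ => E) J) hm]
    let e (t : ℝ≥0) : E := if ht : t ∈ J then g ⟨t, ht⟩ else g ⟨0, hJ⟩
    have he : J.restrict ⁻¹' ({g} : Set ((j : J) → E)) = {p : ℝ≥0 → E | p 0 = e 0 ∧ ∀ t ∈ J.sort, p t = e t} := by
      ext p
      simp only [Set.mem_preimage, Set.mem_singleton_iff, funext_iff, Finset.restrict,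
        Subtype.forall, Set.mem_ofPred_eq, Finset.mem_sort, e]
      constructor
      · intro hp
        refine ⟨?_, fun t ht => ?_⟩
        · rw [dif_pos hJ, hp 0 hJ]
        · rw [dif_pos ht, hp t ht]
      · rintro ⟨_, hp⟩ t ht
        rw [hp t ht, dif_pos ht]
    rw [he]
    exact h e _ (List.pairwise_cons.2 ⟨fun t _ => zero_le, J.pairwise_sort _⟩)
  refine IsProjectiveLimit.unique (P := fun J : Finset ℝ≥0 => μ₂.map J.restrict) (fun J => ?_)
    fun J => rfl
  classical
  -- A set of times without 0 is handled as a marginal of one containing it.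
  have hsub : J ⊆ insert 0 J := Finset.subset_insert 0 J
  have hmap (μ : Measure (ℝ≥0 → E)) : μ.map J.restrict =
      (μ.map (insert 0 J).restrict).map
        (Finset.restrict₂ (π := fun _ => E) hsub) := by
    rw [Measure.map_map (Finset.measurable_restrict₂ (X := fun _ => E) hsub)
      (Finset.measurable_restrict (X := fun _ => E) _), Finset.restrict₂_comp_restrict]
  simp only
  rw [hmap, hmap, h0 _ (Finset.mem_insert_self 0 J)]

section identDistrib

variable {Ω E M I : Type*} [MeasurableSpace Ω] [MeasurableSpace M] [MeasurableSpace I]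
  [MeasurableSpace E] [DiscreteMeasurableSpace E] [Countable E]
  {ν : Measure M} [IsProbabilityMeasure ν] {step : E → M → E} {Λ : ℝ} {z : I → E}

theorem measurable_jumpProcess_of_initial (hstep : ∀ x, Measurable (step x)) (c : E)
    (hz : Measurable z) (t : ℝ) :
    Measurable fun q : I × (ℕ → ℝ × M) => jumpProcess step c (z q.1) t q.2 := by
  have h1 : Measurable fun q : E × (ℕ → ℝ × M) => jumpProcess step c q.1 t q.2 :=
    measurable_from_prod_countable_right fun x =>
      (measurable_jumpProcess step c hstep x).comp measurable_prodMk_left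
  exact h1.comp ((hz.comp measurable_fst).prodMk measurable_snd)

/-- A Markov jump process whose generator is `Λ (K - 1)`, for the transition operator `K` of one
random step, has the law of the jump process driven by exponential times and independent marks. -/
theorem IsMarkovJumpProcess.identDistrib_jumpProcess [TopologicalSpace E] [DiscreteTopology E]
    {P : Measure Ω} [IsProbabilityMeasure P] {X : ℝ≥0 → Ω → E} {L : (E → ℝ) → E → ℝ}
    (hX : IsMarkovJumpProcess L P X) (hΛ : 0 < Λ) (hstep : ∀ x, Measurable (step x))
    (hL : ∀ (f : E →ᵇ ℝ) x, L f x = Λ * ((∫ m, f (step x m) ∂ν) - f x)) (c : E)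
    {γ : Measure I} [IsProbabilityMeasure γ] (hz : Measurable z)
    (h0 : γ.map z = P.map (X 0)) :
    IdentDistrib (fun (q : I × (ℕ → ℝ × M)) (t : ℝ≥0) => jumpProcess step c (z q.1) t q.2)
      (fun ω t => X t ω) (γ.prod (drivingLaw Λ ν)) P := by
  have hP := isProbabilityMeasure_drivingLaw (ν := ν) hΛ
  have hW : Measurable fun (q : I × (ℕ → ℝ × M)) (t : ℝ≥0) =>
      jumpProcess step c (z q.1) t q.2 :=
    measurable_pi_lambda _ fun t => measurable_jumpProcess_of_initial hstep c hz t
  have hXm : Measurable fun ω t => X t ω := measurable_pi_lambda _ hX.measurable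
  refine ⟨hW.aemeasurable, hXm.aemeasurable, ?_⟩
  have hp1 := Measure.isProbabilityMeasure_map (μ := γ.prod (drivingLaw Λ ν)) hW.aemeasurable
  have hp2 := Measure.isProbabilityMeasure_map (μ := P) hXm.aemeasurable
  refine measure_path_ext fun e ts hts => ?_
  let B := stepGenerator Λ ν step hstep
  have hB (f : E →ᵇ ℝ) (x : E) : L f x = B f x := by
    rw [hL]
    rfl
  have hS : MeasurableSet {p : ℝ≥0 → E | p 0 = e 0 ∧ ∀ t ∈ ts, p t = e t} := by
    have h1 : {p : ℝ≥0 → E | p 0 = e 0 ∧ ∀ t ∈ ts, p t = e t} =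
        {p | p 0 = e 0} ∩ ⋂ t ∈ {t | t ∈ ts}, {p | p t = e t} := by
      ext p
      simp
    rw [h1]
    have h2 (t : ℝ≥0) : MeasurableSet {p : ℝ≥0 → E | p t = e t} :=
      measurable_pi_apply (X := fun _ => E) t (.of_discrete (s := {e t}))
    exact (h2 0).inter (.biInter ts.finite_toSet.countable fun t _ => h2 t)
  have he : MeasurableSet ({e 0} : Set E) := .of_discrete
  rw [Measure.map_apply hW hS, Measure.map_apply hXm hS, Measure.prod_apply (hW hS)]
  have hfst (i : I) : drivingLaw Λ ν (Prod.mk i ⁻¹'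
      ((fun (q : I × (ℕ → ℝ × M)) (t : ℝ≥0) => jumpProcess step c (z q.1) t q.2) ⁻¹'
        {p | p 0 = e 0 ∧ ∀ t ∈ ts, p t = e t})) =
      (z ⁻¹' {e 0}).indicator (fun _ => ENNReal.ofReal (pathWeight B e 0 ts)) i := by
    -- At time 0 the transition function is an indicator, so the Markov property just tests the
    -- initial state.
    have h1 := real_markov (ν := ν) (c := c) hΛ hstep e (ts := ts) (o := 0)
      (fun u _ => zero_le) (z i) (e 0) 0
    rw [real_followEvent hΛ hstep e ts hts, transition, NNReal.coe_zero, evolution_zero,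
      one_apply_eq_self, pointIndicator_apply] at h1
    rw [← ofReal_measureReal]
    have h2 : Prod.mk i ⁻¹'
      ((fun (q : I × (ℕ → ℝ × M)) (t : ℝ≥0) => jumpProcess step c (z q.1) t q.2) ⁻¹'
        {p | p 0 = e 0 ∧ ∀ t ∈ ts, p t = e t}) =
        {ω | jumpProcess step c (z i) 0 ω = e 0} ∩ followEvent step c e ts (z i) (0 - 0) := by
      ext ω
      simp [followEvent]
    rw [h2, h1]
    by_cases hi : z i = e 0
    · rw [Set.indicator_of_mem (show z i ∈ ({e 0} : Set E) from hi),
        Set.indicator_of_mem (show i ∈ z ⁻¹' {e 0} from hi), Pi.one_apply, one_mul]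
    · rw [Set.indicator_of_notMem (show z i ∉ ({e 0} : Set E) from hi),
        Set.indicator_of_notMem (show i ∉ z ⁻¹' {e 0} from hi), zero_mul, ENNReal.ofReal_zero]
  rw [lintegral_congr hfst, lintegral_indicator_const (hz he), ← Measure.map_apply hz he, h0,
    Measure.map_apply (hX.measurable 0) he]
  have h3 := hX.real_path_eq hB e ts (A := X 0 ⁻¹' {e 0}) hts
    (measurableSet_history_of_le hX.measurable le_rfl (e 0)) (fun ω hω => hω)
  rw [mul_comm, ← ofReal_measureReal (μ := P) (s := X 0 ⁻¹' {e 0}),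
    ← ENNReal.ofReal_mul measureReal_nonneg, ← h3, ofReal_measureReal]
  rfl

end identDistrib

/-! ## Common marks for the graph model and the reference system -/

theorem exists_coin {q : ℝ} (h0 : 0 ≤ q) (h1 : q ≤ 1) :
    ∃ β : PMF Bool, (β true).toReal = q ∧ (β false).toReal = 1 - q := by
  refine ⟨PMF.ofFintype (fun b => ENNReal.ofReal (cond b q (1 - q))) ?_, ?_, ?_⟩
  · rw [Fintype.sum_bool, cond_true, cond_false, ← ENNReal.ofReal_add h0 (by linarith)]
    simp
  · simp [PMF.ofFintype_apply, h0]
  · simp [PMF.ofFintype_apply, h1]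

theorem sum_toReal_pmf {α : Type*} [Fintype α] (p : PMF α) : ∑ a, (p a).toReal = 1 := by
  have h := p.tsum_coe
  rw [tsum_fintype] at h
  rw [← ENNReal.toReal_sum fun a _ => p.apply_ne_top a, h, ENNReal.toReal_one]

theorem integral_prod_pmf {K M : Type*} [Fintype K] [MeasurableSpace K]
    [MeasurableSingletonClass K] [MeasurableSpace M] (p : PMF K) (ν : Measure M)
    [IsProbabilityMeasure ν] {F : K × M → ℝ} (hF : ∀ k, Measurable fun m => F (k, m)) {C : ℝ}
    (hC : ∀ q, |F q| ≤ C) :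
    ∫ q, F q ∂(p.toMeasure.prod ν) = ∑ k, (p k).toReal * ∫ m, F (k, m) ∂ν := by
  have hm : Measurable F := measurable_from_prod_countable_right hF
  rw [integral_prod _ (Integrable.of_bound hm.aestronglyMeasurable C (ae_of_all _ hC)),
    PMF.integral_eq_sum]
  rfl

/-- One allocation is drawn in advance for each configuration, but a step reads only one of them. -/
theorem integral_eval_infinitePi {ι α : Type*} [Fintype α] [MeasurableSpace α]
    [MeasurableSingletonClass α] (p : ι → PMF α) (i : ι) (h : α → ℝ) :
    ∫ a, h (a i) ∂(Measure.infinitePi fun i => (p i).toMeasure) = ∑ n, (p i n).toReal * h n := by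
  have hmp := measurePreserving_eval_infinitePi (fun i => (p i).toMeasure) i
  have h1 := integral_map (μ := Measure.infinitePi fun i => (p i).toMeasure) (f := h)
    hmp.measurable.aemeasurable (by
      rw [hmp.map_eq]
      exact (measurable_of_finite h).aestronglyMeasurable)
  rw [hmp.map_eq, PMF.integral_eq_sum] at h1
  exact h1.symm

/-- As there are countably many configurations, almost surely all the allocations drawn in advance
are admissible at once. -/
theorem ae_mem_support_infinitePi {ι α : Type*} [Countable ι] [MeasurableSpace α]
    [DiscreteMeasurableSpace α] (p : ι → PMF α) :
    ∀ᵐ a ∂(Measure.infinitePi fun i => (p i).toMeasure), ∀ i, a i ∈ (p i).support := by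
  refine ae_all_iff.2 fun i => ?_
  refine (measurePreserving_eval_infinitePi
    (fun i => (p i).toMeasure) i).quasiMeasurePreserving.ae (p := fun n => n ∈ (p i).support) ?_
  change (p i).toMeasure (p i).supportᶜ = 0
  rw [PMF.toMeasure_apply_eq_zero_iff _ .of_discrete]
  exact disjoint_compl_right

/-- A mark consists of a vertex or rank, two coins which select the kind of the event (an arrival,
or a departure also of type II jobs), and random allocations for all configurations. -/
abbrev Mark (N : ℕ) : Type :=
  Fin N × Bool × Bool × (Fin N × AffState N → Fin N) × (RefState N → Fin N)

/-- The law of the marks. -/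
noncomputable def markLaw {N k : ℕ} [NeZero N] {G : SimpleGraph (Fin N)} (affPol : AffinityPolicy G)
    (refPol : MJSQPolicy N k) (β₁ β₂ : PMF Bool) : Measure (Mark N) :=
  (PMF.uniformOfFintype (Fin N)).toMeasure.prod (β₁.toMeasure.prod (β₂.toMeasure.prod
    ((Measure.infinitePi fun i : Fin N × AffState N => (affPol.prob i.1 i.2).toMeasure).prod
      (Measure.infinitePi fun y => (refPol.prob y).toMeasure))))

instance isProbabilityMeasure_markLaw {N k : ℕ} [NeZero N] {G : SimpleGraph (Fin N)}
    (affPol : AffinityPolicy G) (refPol : MJSQPolicy N k) (β₁ β₂ : PMF Bool) :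
    IsProbabilityMeasure (markLaw affPol refPol β₁ β₂) := by
  rw [markLaw]
  infer_instance

/-- The effect of a mark on the graph model. -/
noncomputable def affStep {N : ℕ} (G : SimpleGraph (Fin N)) (x : AffState N) (m : Mark N) :
    AffState N :=
  if m.2.1 then affArrival G m.1 x (m.2.2.2.1 (m.1, x))
  else if 0 < (x (Tuple.sort (typeI x) m.1)).1 ∨ m.2.2.1 then
    affDeparture x (Tuple.sort (typeI x) m.1)
  else x

/-- The effect of a mark on the reference system. -/
def refStep {N : ℕ} (y : RefState N) (m : Mark N) : RefState N :=
  if m.2.1 then Function.update y (m.2.2.2.2 y) (y (m.2.2.2.2 y) + 1)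
  else Function.update y (Tuple.sort y m.1) (y (Tuple.sort y m.1) - 1)

section marks

variable {N k : ℕ} {G : SimpleGraph (Fin N)}

theorem measurable_affStep_allocation (x : AffState N) (v : Fin N) (b₁ b₂ : Bool) :
    Measurable fun a : (Fin N × AffState N → Fin N) × (RefState N → Fin N) =>
      affStep G x (v, b₁, b₂, a) := by
  cases b₁
  · simp only [affStep, Bool.false_eq_true, if_false]
    exact measurable_const
  · exact (Measurable.of_discrete (f := fun n => affArrival G v x n)).comp
      ((measurable_pi_apply (v, x)).comp measurable_fst)

theorem measurable_refStep_allocation (y : RefState N) (v : Fin N) (b₁ b₂ : Bool) :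
    Measurable fun a : (Fin N × AffState N → Fin N) × (RefState N → Fin N) =>
      refStep y (v, b₁, b₂, a) := by
  cases b₁
  · simp only [refStep, Bool.false_eq_true, if_false]
    exact measurable_const
  · exact (Measurable.of_discrete (f := fun n => Function.update y n (y n + 1))).comp
      ((measurable_pi_apply y).comp measurable_snd)

theorem measurable_of_allocation {E : Type*} [MeasurableSpace E] {F : Mark N → E}
    (h : ∀ v b₁ b₂, Measurable fun a => F (v, b₁, b₂, a)) : Measurable F :=
  measurable_from_prod_countable_right fun v => measurable_from_prod_countable_right fun b₁ =>
    measurable_from_prod_countable_right fun b₂ => h v b₁ b₂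

theorem measurable_affStep (x : AffState N) : Measurable (affStep G x) :=
  measurable_of_allocation (measurable_affStep_allocation x)

theorem measurable_refStep (y : RefState N) : Measurable (refStep y) :=
  measurable_of_allocation (measurable_refStep_allocation y)

theorem integral_markLaw [NeZero N] (affPol : AffinityPolicy G) (refPol : MJSQPolicy N k)
    (β₁ β₂ : PMF Bool) {F : Mark N → ℝ} (hF : ∀ v b₁ b₂, Measurable fun a => F (v, b₁, b₂, a))
    {C : ℝ} (hC : ∀ m, |F m| ≤ C) :
    ∫ m, F m ∂(markLaw affPol refPol β₁ β₂) =
      ∑ v, (N : ℝ)⁻¹ * ∑ b₁, (β₁ b₁).toReal * ∑ b₂, (β₂ b₂).toReal * ∫ a, F (v, b₁, b₂, a)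
        ∂((Measure.infinitePi fun i : Fin N × AffState N => (affPol.prob i.1 i.2).toMeasure).prod
          (Measure.infinitePi fun y => (refPol.prob y).toMeasure)) := by
  rw [markLaw, integral_prod_pmf _ _ (fun v => measurable_from_prod_countable_right fun b₁ =>
    measurable_from_prod_countable_right fun b₂ => hF v b₁ b₂) hC]
  refine Finset.sum_congr rfl fun v _ => ?_
  rw [integral_prod_pmf _ _ (fun b₁ => measurable_from_prod_countable_right fun b₂ => hF v b₁ b₂)
    fun q => hC (v, q)]
  congr 1
  · simp
  · refine Finset.sum_congr rfl fun b₁ _ => ?_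
    rw [integral_prod_pmf _ _ (fun b₂ => hF v b₁ b₂) fun q => hC (v, b₁, q)]

/-- Uniformization: a given index rings at rate `lam + μ₁`, which the first coin splits into
arrivals at rate `lam` and service at rate `μ₁`. Sorting permutes the servers, so summing over ranks
is summing over servers. -/
theorem affGenerator_eq [NeZero N] (affPol : AffinityPolicy G) (refPol : MJSQPolicy N k)
    {β₁ β₂ : PMF Bool} {lam μ₁ μ₂ : ℝ} (hr : 0 < lam + μ₁) (hμ₁ : 0 < μ₁)
    (h₁ : (β₁ true).toReal = lam / (lam + μ₁)) (h₁' : (β₁ false).toReal = 1 - lam / (lam + μ₁))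
    (h₂ : (β₂ true).toReal = μ₂ / μ₁) (h₂' : (β₂ false).toReal = 1 - μ₂ / μ₁)
    {f : AffState N → ℝ} {C : ℝ} (hC : ∀ x, |f x| ≤ C) (x : AffState N) :
    affGenerator G affPol lam μ₁ μ₂ f x =
      N * (lam + μ₁) * ((∫ m, f (affStep G x m) ∂(markLaw affPol refPol β₁ β₂)) - f x) := by
  have hN : (N : ℝ) ≠ 0 := NeZero.ne _
  have harr (v : Fin N) (b : Bool) : ∫ a, f (affStep G x (v, true, b, a))
      ∂((Measure.infinitePi fun i : Fin N × AffState N => (affPol.prob i.1 i.2).toMeasure).prod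
        (Measure.infinitePi fun y => (refPol.prob y).toMeasure)) =
      ∑ n, (affPol.prob v x n).toReal * f (affArrival G v x n) := by
    have h := integral_eval_infinitePi (fun i : Fin N × AffState N => affPol.prob i.1 i.2) (v, x)
      (fun n => f (affArrival G v x n))
    rw [← h]
    have h2 := integral_fun_fst
      (μ := Measure.infinitePi fun i : Fin N × AffState N => (affPol.prob i.1 i.2).toMeasure)
      (ν := Measure.infinitePi fun y => (refPol.prob y).toMeasure)
      fun a => f (affArrival G v x (a (v, x)))
    rw [probReal_univ, one_smul] at h2
    exact h2
  have hdep (v : Fin N) (b : Bool) : ∫ a, f (affStep G x (v, false, b, a))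
      ∂((Measure.infinitePi fun i : Fin N × AffState N => (affPol.prob i.1 i.2).toMeasure).prod
        (Measure.infinitePi fun y => (refPol.prob y).toMeasure)) =
      if 0 < (x (Tuple.sort (typeI x) v)).1 ∨ b then f (affDeparture x (Tuple.sort (typeI x) v))
      else f x := by
    simp only [affStep, Bool.false_eq_true, if_false, integral_const, probReal_univ, one_smul]
    split_ifs <;> rfl
  -- Without type I jobs the second coin thins `μ₁` to `μ₁ * (μ₂ / μ₁) = μ₂`; at an idle server the
  -- departure changes nothing.
  have hrate (n : Fin N) : μ₁ * (μ₂ / μ₁ * f (affDeparture x n) + (1 - μ₂ / μ₁) *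
        (if 0 < (x n).1 then f (affDeparture x n) else f x) - f x) =
      affServiceRate μ₁ μ₂ x n * (f (affDeparture x n) - f x) := by
    rw [affServiceRate]
    by_cases hn : 0 < (x n).1
    · simp only [hn, if_true]
      ring
    · simp only [hn, if_false]
      by_cases hn' : 0 < (x n).2
      · rw [if_pos hn']
        field_simp
        ring
      · have : affDeparture x n = x := by
          rw [affDeparture, if_neg hn, Function.update_eq_self_iff]
          exact Prod.ext rfl (by simp only; omega)
        rw [this, if_neg hn']
        ring
  rw [integral_markLaw affPol refPol β₁ β₂
    (fun v b₁ b₂ => (Measurable.of_discrete (f := f)).comp (measurable_affStep_allocation x v b₁ b₂))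
    fun m => hC _, affGenerator]
  simp only [Fintype.sum_bool, harr, hdep, h₁, h₁', h₂, h₂', or_true, if_true, Bool.false_eq_true,
    or_false]
  rw [← Equiv.sum_comp (Tuple.sort (typeI x))
      fun n => affServiceRate μ₁ μ₂ x n * (f (affDeparture x n) - f x), ← Finset.sum_add_distrib, ← Finset.mul_sum, mul_sub,
    mul_comm (N : ℝ), mul_assoc, mul_inv_cancel_left₀ hN, mul_assoc (lam + μ₁), ← nsmul_eq_mul]
  have hcard : N • f x = ∑ _v : Fin N, f x := by simp
  rw [hcard, ← mul_sub, ← Finset.sum_sub_distrib, Finset.mul_sum]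
  refine Finset.sum_congr rfl fun v _ => ?_
  rw [← hrate]
  have hsum : ∑ n, lam * (affPol.prob v x n).toReal * (f (affArrival G v x n) - f x) =
      lam * (∑ n, (affPol.prob v x n).toReal * f (affArrival G v x n) - f x) := by
    have h3 := sum_toReal_pmf (affPol.prob v x)
    conv_rhs => rw [← one_mul (f x), ← h3, Finset.sum_mul, ← Finset.sum_sub_distrib,
      Finset.mul_sum]
    exact Finset.sum_congr rfl fun n _ => by ring
  rw [hsum]
  field_simp
  ring

/-- Arrivals ignore the index, so the `N` indices add up to rate `lam * N`. The second coin sums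
out, and departures at empty servers are void. -/
theorem refGenerator_eq [NeZero N] (affPol : AffinityPolicy G) (refPol : MJSQPolicy N k)
    {β₁ β₂ : PMF Bool} {lam μ₁ : ℝ} (hr : 0 < lam + μ₁)
    (h₁ : (β₁ true).toReal = lam / (lam + μ₁)) (h₁' : (β₁ false).toReal = 1 - lam / (lam + μ₁))
    {f : RefState N → ℝ} {C : ℝ} (hC : ∀ x, |f x| ≤ C) (y : RefState N) :
    refGenerator refPol lam μ₁ f y =
      N * (lam + μ₁) * ((∫ m, f (refStep y m) ∂(markLaw affPol refPol β₁ β₂)) - f y) := by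
  have hN : (N : ℝ) ≠ 0 := NeZero.ne _
  have harr (v : Fin N) (b : Bool) : ∫ a, f (refStep y (v, true, b, a))
      ∂((Measure.infinitePi fun i : Fin N × AffState N => (affPol.prob i.1 i.2).toMeasure).prod
        (Measure.infinitePi fun y => (refPol.prob y).toMeasure)) =
      ∑ n, (refPol.prob y n).toReal * f (Function.update y n (y n + 1)) := by
    have h := integral_eval_infinitePi refPol.prob y (fun n => f (Function.update y n (y n + 1)))
    rw [← h]
    have h2 := integral_fun_snd
      (μ := Measure.infinitePi fun i : Fin N × AffState N => (affPol.prob i.1 i.2).toMeasure)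
      (ν := Measure.infinitePi fun y => (refPol.prob y).toMeasure)
      fun a => f (Function.update y (a y) (y (a y) + 1))
    rw [probReal_univ, one_smul] at h2
    exact h2
  have hdep (v : Fin N) (b : Bool) : ∫ a, f (refStep y (v, false, b, a))
      ∂((Measure.infinitePi fun i : Fin N × AffState N => (affPol.prob i.1 i.2).toMeasure).prod
        (Measure.infinitePi fun y => (refPol.prob y).toMeasure)) =
      f (Function.update y (Tuple.sort y v) (y (Tuple.sort y v) - 1)) := by
    simp only [refStep, Bool.false_eq_true, if_false, integral_const, probReal_univ, one_smul]
  have hrate (n : Fin N) : μ₁ * (f (Function.update y n (y n - 1)) - f y) =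
      (if 0 < y n then μ₁ else 0) * (f (Function.update y n (y n - 1)) - f y) := by
    split_ifs with hn
    · rfl
    · have : Function.update y n (y n - 1) = y := by
        rw [Function.update_eq_self_iff]
        omega
      rw [this]
      ring
  rw [integral_markLaw affPol refPol β₁ β₂
    (fun v b₁ b₂ => (Measurable.of_discrete (f := f)).comp (measurable_refStep_allocation y v b₁ b₂))
    fun m => hC _, refGenerator]
  have h2 := sum_toReal_pmf β₂
  rw [Fintype.sum_bool] at h2
  simp only [Fintype.sum_bool, harr, hdep, h₁, h₁', ← add_mul, h2, one_mul]
  rw [← Equiv.sum_comp (Tuple.sort y)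
      fun n => (if 0 < y n then μ₁ else 0) * (f (Function.update y n (y n - 1)) - f y), ← Finset.mul_sum, mul_sub,
    mul_comm (N : ℝ), mul_assoc, mul_inv_cancel_left₀ hN, mul_assoc (lam + μ₁), ← nsmul_eq_mul]
  have hcard : N • f y = ∑ _v : Fin N, f y := by simp
  have hsum : ∑ n, lam * N * (refPol.prob y n).toReal * (f (Function.update y n (y n + 1)) - f y) =
      ∑ _v : Fin N,
        lam * (∑ n, (refPol.prob y n).toReal * f (Function.update y n (y n + 1)) - f y) := by
    have h3 := sum_toReal_pmf (refPol.prob y)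
    rw [Finset.sum_const, Finset.card_univ, Fintype.card_fin, nsmul_eq_mul]
    conv_rhs => rw [← one_mul (f y), ← h3, Finset.sum_mul, ← Finset.sum_sub_distrib,
      Finset.mul_sum, Finset.mul_sum]
    exact Finset.sum_congr rfl fun n _ => by ring
  rw [hsum, hcard, ← mul_sub, ← Finset.sum_sub_distrib, Finset.mul_sum, ← Finset.sum_add_distrib]
  refine Finset.sum_congr rfl fun v _ => ?_
  rw [← hrate]
  field_simp
  ring

/-- Almost every mark preserves the order of the two systems. -/
theorem ae_markLaw_tailLE [NeZero N] [DecidableRel G.Adj] (hG : N - k - 1 ≤ G.minDegree)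
    (affPol : AffinityPolicy G) (refPol : MJSQPolicy N k) (β₁ β₂ : PMF Bool) :
    ∀ᵐ m ∂(markLaw affPol refPol β₁ β₂), ∀ (x : AffState N) (y : RefState N),
      TailLE (typeI x) y → TailLE (typeI (affStep G x m)) (refStep y m) := by
  have h1 := ae_mem_support_infinitePi fun i : Fin N × AffState N => affPol.prob i.1 i.2
  have h2 := ae_mem_support_infinitePi refPol.prob
  have h3 := (Measure.quasiMeasurePreserving_fst
    (ν := Measure.infinitePi fun y => (refPol.prob y).toMeasure)).ae h1
  have h4 := (Measure.quasiMeasurePreserving_snd (μ := Measure.infinitePi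
    fun i : Fin N × AffState N => (affPol.prob i.1 i.2).toMeasure)).ae h2
  have h5 := Measure.quasiMeasurePreserving_snd (μ := (PMF.uniformOfFintype (Fin N)).toMeasure) |>.ae
    (Measure.quasiMeasurePreserving_snd (μ := β₁.toMeasure) |>.ae
      (Measure.quasiMeasurePreserving_snd (μ := β₂.toMeasure) |>.ae (h3.and h4)))
  rw [markLaw]
  filter_upwards [h5] with m hm x y hxy
  rw [affStep, refStep]
  by_cases hb : m.2.1 = true
  · rw [if_pos hb, if_pos hb]
    exact hxy.affArrival hG (affPol.mayAllocate _ _ _ (hm.1 (m.1, x)))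
      (refPol.hasOrderedLength _ _ (hm.2 y))
  · rw [if_neg hb, if_neg hb]
    have h6 := hxy.departure (Tuple.monotone_sort (typeI x)) (Tuple.monotone_sort y) m.1
    rw [← typeI_affDeparture] at h6
    split_ifs with h7
    · exact h6
    -- A suppressed departure would have removed no type I job, so for the type I counts it may be
    -- treated as carried out.
    · convert h6 using 1
      rw [typeI_affDeparture, eq_comm, Function.update_eq_self_iff]
      have : ¬ 0 < typeI x (Tuple.sort (typeI x) m.1) := fun h => h7 (.inl h)
      omega

end marks

/-! ### From single marks to whole paths, and the coupling -/

theorem ae_drivingLaw_of_ae_mark {M : Type*} [MeasurableSpace M] {ν : Measure M}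
    [IsProbabilityMeasure ν] {Λ : ℝ} (hΛ : 0 < Λ) {p : M → Prop} (hp : ∀ᵐ m ∂ν, p m) :
    ∀ᵐ ω ∂(drivingLaw Λ ν), ∀ i, p (ω i).2 := by
  have := isProbabilityMeasure_expMeasure hΛ
  refine ae_all_iff.2 fun i => ?_
  exact (measurePreserving_eval_infinitePi
    (fun _ : ℕ => (expMeasure Λ).prod ν) i).quasiMeasurePreserving.ae
      (Measure.quasiMeasurePreserving_snd.ae hp)

theorem RightContinuousPath.comp {E F : Type*} {x : ℝ≥0 → E} (hx : RightContinuousPath x)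
    (g : E → F) : RightContinuousPath fun t => g (x t) := fun t =>
  (hx t).mono fun _ hs => congrArg g hs

theorem identDistrib_comp_path {Ω₁ Ω₂ E F : Type*} [MeasurableSpace Ω₁]
    [MeasurableSpace Ω₂] [MeasurableSpace E] [MeasurableSpace F] {P₁ : Measure Ω₁}
    {P₂ : Measure Ω₂} {X : Ω₁ → ℝ≥0 → E} {Y : Ω₂ → ℝ≥0 → E} (h : IdentDistrib X Y P₁ P₂)
    {g : E → F} (hg : Measurable g) :
    IdentDistrib (fun ω t => g (X ω t)) (fun ω t => g (Y ω t)) P₁ P₂ := by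
  have hu : Measurable fun (p : ℝ≥0 → E) (t : ℝ≥0) => g (p t) :=
    measurable_pi_iff.2 fun t => hg.comp (measurable_pi_apply (X := fun _ => E) t)
  exact h.comp hu

/-- The tail sums of type I jobs in the graph model are stochastically dominated by the tail sums in
the reference system: both systems are driven by the same exponential times and marks. -/
theorem processStochLE_tailSum {N k : ℕ} (hk : k < N) (G : SimpleGraph (Fin N)) [DecidableRel G.Adj]
    (hG : N - k - 1 ≤ G.minDegree)
    (lam μ₁ μ₂ : ℝ) (hlam : 0 ≤ lam) (hμ₂ : 0 < μ₂) (hμ : μ₂ < μ₁)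
    (affPol : AffinityPolicy G)
    (refPol : MJSQPolicy N k)
    {Ω₁ Ω₂ : Type*} [MeasurableSpace Ω₁] [MeasurableSpace Ω₂]
    (P₁ : Measure Ω₁) (P₂ : Measure Ω₂) [IsProbabilityMeasure P₁] [IsProbabilityMeasure P₂]
    (X : ℝ≥0 → Ω₁ → AffState N)
    (Y : ℝ≥0 → Ω₂ → RefState N)
    (hX : IsMarkovJumpProcess
      (affGenerator G affPol lam μ₁ μ₂) P₁ X)
    (hY : IsMarkovJumpProcess
      (refGenerator refPol lam μ₁) P₂ Y)
    (h0 : InitiallyOrdered (P₁.map (X 0)) (P₂.map (Y 0))) :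
    ProcessStochLE P₁ P₂
      (fun t ω => tailSum (typeI (X t ω)))
      (fun t ω => tailSum (Y t ω)) := by
  have : NeZero N := ⟨by omega⟩
  have hμ₁ : 0 < μ₁ := hμ₂.trans hμ
  have hr : 0 < lam + μ₁ := by linarith
  have hN : (0 : ℝ) < N := by exact_mod_cast (Nat.zero_le k).trans_lt hk
  have hΛ : 0 < N * (lam + μ₁) := mul_pos hN hr
  obtain ⟨β₁, hβ₁, hβ₁'⟩ := exists_coin (q := lam / (lam + μ₁)) (by positivity)
    ((div_le_one hr).2 (by linarith))
  obtain ⟨β₂, hβ₂, hβ₂'⟩ := exists_coin (q := μ₂ / μ₁) (by positivity)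
    ((div_le_one hμ₁).2 hμ.le)
  obtain ⟨γ, hγ₁, hγ₂, hγ⟩ := h0
  have hγP : IsProbabilityMeasure γ := by
    have h1 := Measure.isProbabilityMeasure_map (μ := P₁) (hX.measurable 0).aemeasurable
    rw [← hγ₁] at h1
    exact Measure.isProbabilityMeasure_of_map Prod.fst
  let ν := markLaw affPol refPol β₁ β₂
  have hP := isProbabilityMeasure_drivingLaw (ν := ν) hΛ
  have hX' := hX.identDistrib_jumpProcess (ν := ν) hΛ (measurable_affStep (G := G))
    (fun f x => affGenerator_eq affPol refPol hr hμ₁ hβ₁ hβ₁' hβ₂ hβ₂' f.norm_coe_le_norm x)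
    (0 : AffState N) measurable_fst hγ₁
  have hY' := hY.identDistrib_jumpProcess (ν := ν) hΛ measurable_refStep
    (fun f y => refGenerator_eq affPol refPol hr hβ₁ hβ₁' f.norm_coe_le_norm y)
    (0 : RefState N) measurable_snd hγ₂
  -- The joint space: the coupled initial states, and independently of them one driving sequence
  -- shared by both systems.
  refine ⟨(AffState N × RefState N) × (ℕ → ℝ × Mark N), inferInstance,
    γ.prod (drivingLaw (N * (lam + μ₁)) ν), inferInstance,
    fun t q => tailSum (typeI (jumpProcess (affStep G) 0 q.1.1 t q.2)),
    fun t q => tailSum (jumpProcess refStep 0 q.1.2 t q.2), ?_, ?_, ?_, ?_⟩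
  · exact identDistrib_comp_path hX' (g := fun x => tailSum (typeI x)) .of_discrete
  · exact identDistrib_comp_path hY' (g := fun y => tailSum y) .of_discrete
  · refine ae_of_all _ fun q => ⟨?_, ?_⟩
    · exact (rightContinuousPath_jumpProcess (affStep G) 0 q.1.1 q.2).comp
        fun x => tailSum (typeI x)
    · exact (rightContinuousPath_jumpProcess refStep 0 q.1.2 q.2).comp fun y => tailSum y
  · have h1 := ae_drivingLaw_of_ae_mark hΛ (ae_markLaw_tailLE hG affPol refPol β₁ β₂)
    filter_upwards [Measure.quasiMeasurePreserving_fst.ae hγ,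
      Measure.quasiMeasurePreserving_snd.ae h1] with q hq hω t
    refine (tailLE_iff _ _).1 ?_
    -- The default states after an explosion are both 0 and hence ordered, so non-explosion need not
    -- be proved.
    exact jumpProcess_rel (affStep G) 0 (step' := refStep)
      (R := fun (x : AffState N) (y : RefState N) => TailLE (typeI x) y) (c' := 0)
      (fun _ _ => le_rfl) hω ((tailLE_iff _ _).2 hq) t

end AffinityScheduling

/-- Consider the graph model on a graph with minimum degree at least `N - k - 1`, and an
`N`-server system under MJSQ(`k`), with ordered initial conditions. Then the process of tail sums
of type I jobs is stochastically dominated by the process of tail sums under MJSQ(`k`). -/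
theorem theorem2 {N k : ℕ} (hk : k < N) (G : SimpleGraph (Fin N)) [DecidableRel G.Adj]
    (hG : N - k - 1 ≤ G.minDegree)
    (lam μ₁ μ₂ : ℝ) (hlam : 0 ≤ lam) (hμ₂ : 0 < μ₂) (hμ : μ₂ < μ₁)
    (affPol : AffinityScheduling.AffinityPolicy G)
    (refPol : AffinityScheduling.MJSQPolicy N k)
    {Ω₁ Ω₂ : Type*} [MeasurableSpace Ω₁] [MeasurableSpace Ω₂]
    (P₁ : Measure Ω₁) (P₂ : Measure Ω₂) [IsProbabilityMeasure P₁] [IsProbabilityMeasure P₂]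
    (X : ℝ≥0 → Ω₁ → AffinityScheduling.AffState N)
    (Y : ℝ≥0 → Ω₂ → AffinityScheduling.RefState N)
    (hX : AffinityScheduling.IsMarkovJumpProcess
      (AffinityScheduling.affGenerator G affPol lam μ₁ μ₂) P₁ X)
    (hY : AffinityScheduling.IsMarkovJumpProcess
      (AffinityScheduling.refGenerator refPol lam μ₁) P₂ Y)
    (h0 : AffinityScheduling.InitiallyOrdered (P₁.map (X 0)) (P₂.map (Y 0))) :
    AffinityScheduling.ProcessStochLE P₁ P₂
      (fun t ω => AffinityScheduling.tailSum (AffinityScheduling.typeI (X t ω)))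
      (fun t ω => AffinityScheduling.tailSum (Y t ω)) := by
  exact AffinityScheduling.processStochLE_tailSum hk G hG lam μ₁ μ₂ hlam hμ₂ hμ affPol refPol P₁ P₂ X Y
    hX hY h0
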